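/- Let $M$ be a closed connected orientable smooth surface and let $f\colon M\to\mathbb{R}^2$ be a fold map, i.e. a smooth map such that around every singular point (a point where $df$ is not surjective) and its image there are smooth coordinates, centred at the singular point, in which $f$ has the form $(x_1,x_2)\mapsto(x_1,x_2^2)$. Let $\pi\colon\mathbb{R}^3\to\mathbb{R}^2$, $(x,y,z)\mapsto(x,y)$, be the standard projection. Suppose that $f$ has an embedding lift to $\mathbb{R}^3$, i.e. there is a smooth embedding $\eta\colon M\to\mathbb{R}^3$ with $f=\pi\circ\eta$, and that $\sharp f^{-1}(r)\le 2$ for every $r\in\mathbb{R}^2$. Then $f$ extends to a boundary special generic map. More precisely, for every embedding lift $\eta$ of $f$, let $N\subset\mathbb{R}^3$ be the region bounded by $\eta(M)$, that is, the union of $\eta(M)$ and the bounded connected components of $\mathbb{R}^3\setminus\eta(M)$. Then: (1) $N$ is a compact connected smooth $3$-manifold with boundary, smoothly embedded in $\mathbb{R}^3$, and $\eta$ is a smooth embedding of $M$ into $N$ whose image is $\partial N$; (2) $F=\pi|_N\colon N\to\mathbb{R}^2$ satisfies $F\circ\eta=f$, so that $F$ is an extension of $f$ when $M$ is identified with $\partial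 N$ by $\eta$; (3) $F$ is a boundary special generic map: it is a submersion (its differential is surjective at every point of $N$), and every singular point $p\in\partial N$ of $F|_{\partial N}$ is a boundary definite fold point of $F$, i.e. there are smooth coordinates $(x_1,x_2,x_3)$ of $N$ centred at $p$, in which $x_3>0$ and $x_3=0$ correspond to $\operatorname{Int}N$ and $\partial N$, and smooth coordinates of $\mathbb{R}^2$ around $F(p)$, in which $F$ has the form $(x_1,x_2,x_3)\mapsto(x_1,x_2^2+x_3)$. -/

import Mathlib

open scoped Manifold ContDiff

/-- The plane `ℝ²`. -/
abbrev Plane : Type := EuclideanSpace ℝ (Fin 2)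

/-- Three-space `ℝ³`. -/
abbrev Space : Type := EuclideanSpace ℝ (Fin 3)

/-- The standard projection `ℝ³ → ℝ²`, `(x₀, x₁, x₂) ↦ (x₀, x₁)`. -/
noncomputable def stdProj (x : Space) : Plane := !₂[x 0, x 1]

section Surface

variable {M : Type*} [TopologicalSpace M] [ChartedSpace Plane M]

/-- A smooth surface is orientable if it is covered by smooth charts all of whose coordinate
changes have positive Jacobian determinant. -/
def IsOrientableSurface (M : Type*) [TopologicalSpace M] [ChartedSpace Plane M] : Prop :=
  ∃ A : Set (OpenPartialHomeomorph M Plane),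
    A ⊆ IsManifold.maximalAtlas (𝓡 2) ∞ M ∧
    (∀ x : M, ∃ φ ∈ A, x ∈ φ.source) ∧
    ∀ φ ∈ A, ∀ ψ ∈ A, ∀ y ∈ (φ.symm.trans ψ).source,
      0 < (fderiv ℝ (φ.symm.trans ψ) y).det

/-- `p` is a fold point of `f : M → ℝ²`: in smooth coordinates `(x₀, x₁)` centred at `p` and
suitable smooth coordinates around `f p`, the map is `(x₀, x₁) ↦ (x₀, x₁²)`. -/
def IsFoldPoint (f : M → Plane) (p : M) : Prop :=
  ∃ φ ∈ IsManifold.maximalAtlas (𝓡 2) ∞ M, ∃ ψ ∈ IsManifold.maximalAtlas (𝓡 2) ∞ Plane,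
    p ∈ φ.source ∧ φ p = 0 ∧
    ∀ q ∈ φ.source, f q ∈ ψ.source ∧ ψ (f q) = !₂[φ q 0, (φ q 1) ^ 2]

/-- A fold map from a surface to the plane: a smooth map all of whose singular points are
fold points. -/
structure IsFoldMap (f : M → Plane) : Prop where
  smooth : ContMDiff (𝓡 2) (𝓡 2) ∞ f
  fold : ∀ p : M, ¬ Function.Surjective (mfderiv (𝓡 2) (𝓡 2) f p) → IsFoldPoint f p

/-- `η` is an embedding lift of `f` to `ℝ³`. -/
structure IsEmbeddingLift (f : M → Plane) (η : M → Space) : Prop where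
  embedding : Manifold.IsSmoothEmbedding (𝓡 2) (𝓡 3) ∞ η
  lift : ∀ x, stdProj (η x) = f x

end Surface

section ManifoldWithBoundary

variable {N : Type*} [TopologicalSpace N] [ChartedSpace (EuclideanHalfSpace 3) N]

/-- `v ∈ T_pN`, `p ∈ ∂N`, is tangent to `∂N`: the differential of the preferred chart at `p`
kills its normal component. (The half space is `{x | 0 ≤ x 0}`, so the normal coordinate is the
one with index `0`.) -/
def IsTangentToBoundary (p : N) (v : TangentSpace (𝓡∂ 3) p) : Prop :=
  (show Space from mfderiv (𝓡∂ 3) (𝓡 3) (extChartAt (𝓡∂ 3) p) p v) 0 = 0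

/-- `p ∈ ∂N` is a singular point of the restriction `F|∂N`: the differential of `F` at `p` does not
map `T_p(∂N)` onto `T_{F p}ℝ²`. -/
def IsBoundarySingularPoint (F : N → Plane) (p : N) : Prop :=
  p ∈ (𝓡∂ 3).boundary N ∧
    ¬ ∀ w : TangentSpace (𝓡 2) (F p), ∃ v : TangentSpace (𝓡∂ 3) p,
      IsTangentToBoundary p v ∧ mfderiv (𝓡∂ 3) (𝓡 2) F p v = w

/-- `p ∈ ∂N` is a boundary definite fold point of `F : N → ℝ²`: in smooth coordinates
`(x₁, x₂, x₀)` centred at `p`, with `x₀ > 0` in the interior and `x₀ = 0` on the boundary, and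
suitable smooth coordinates around `F p`, the map is `(x₁, x₂, x₀) ↦ (x₁, x₂² + x₀)`. -/
def IsBoundaryDefiniteFoldPoint (F : N → Plane) (p : N) : Prop :=
  p ∈ (𝓡∂ 3).boundary N ∧
  ∃ φ ∈ IsManifold.maximalAtlas (𝓡∂ 3) ∞ N, ∃ ψ ∈ IsManifold.maximalAtlas (𝓡 2) ∞ Plane,
    p ∈ φ.source ∧ (φ p).1 = 0 ∧
    ∀ q ∈ φ.source, F q ∈ ψ.source ∧ ψ (F q) = !₂[(φ q).1 1, ((φ q).1 2) ^ 2 + (φ q).1 0]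

/-- `F : N → ℝ²` is a boundary special generic map on the `3`-manifold with boundary `N`.
Submersivity is surjectivity of the differential at every point, boundary points included. -/
structure IsBoundarySpecialGeneric (F : N → Plane) : Prop where
  compact : CompactSpace N
  connected : ConnectedSpace N
  boundary_nonempty : ((𝓡∂ 3).boundary N).Nonempty
  smooth : ContMDiff (𝓡∂ 3) (𝓡 2) ∞ F
  submersion : ∀ p : N, Function.Surjective (mfderiv (𝓡∂ 3) (𝓡 2) F p)
  boundary_fold : ∀ p : N, IsBoundarySingularPoint F p → IsBoundaryDefiniteFoldPoint F p

/-- `F : N → ℝ²` is an extension of `f : M → ℝ²` through `i : M → N`, which identifies `M`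
with the boundary of `N`. -/
structure IsExtensionThrough {M : Type*} [TopologicalSpace M] [ChartedSpace Plane M]
    (f : M → Plane) (F : N → Plane) (i : M → N) : Prop where
  embedding : Manifold.IsSmoothEmbedding (𝓡 2) (𝓡∂ 3) ∞ i
  range_eq : Set.range i = (𝓡∂ 3).boundary N
  comm : ∀ x, F (i x) = f x

end ManifoldWithBoundary

/-- The region bounded by `S ⊆ ℝ³`: the union of `S` and the bounded connected components of its
complement. -/
def boundedRegion (S : Set Space) : Set Space :=
  S ∪ {x | x ∉ S ∧ Bornology.IsBounded (connectedComponentIn Sᶜ x)}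

open Set Filter Topology

/-! Call a point of `M` a sheet point if `f` is a local diffeomorphism there; every other point is a
fold point. The region is described explicitly: `sheetRegion f η univ` is the union of `η(M)` and
the vertical segments joining the two points of each fibre that contains a sheet point. Fibres made
of two fold points must be left out. There two folds may open in opposite directions over the same
value, and the segment between them lies outside `N`.

The bound on the fibres does its work through twins: near a fold point every sheet point has a
second point of its fibre nearby, so any third point far away is excluded. It follows that a fibre
does not mix sheet and fold points (`not_isSheetPoint_of_fiber`) and that the pairs spanning the
segments form a closed set (`isClosed_sheetPairs`), so the union of segments is compact. An
open-closed argument in the plane shows that a sheet point is never alone in its fibre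
(`exists_ne_of_isSheetPoint`). The union of segments minus `η(M)` is open, so it is a union of
bounded components of the complement of `η(M)`. From any other point off `η(M)`, a vertical ray,
started at a nearby point if necessary, escapes to infinity. This gives `boundedRegion_eq`.

The smooth structure comes from diffeomorphisms of open sets of `ℝ³` which straighten the pair `(N,
η(M))`. At a sheet point `N` is locally one side of a graph. At a fold point, in coordinates `(s,
t)` of the plane with `f = (s, v²)`, the differential of `f` kills the `v` direction. Since `η` is
an immersion, the height `z = h(s, v)` then has nonzero `v`-derivative, so `(s, v)` can be recovered
from `(s, z)`. As `h(s, ·)` is monotone, `N` is `v² ≤ t`, and the coordinates `(t - v², s, v)` put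
`π` in the form `(s, v² + (t - v²))`, the boundary definite fold. Submersivity is automatic, because
`N` has codimension zero in `ℝ³`. A singular point of `F` on `∂N` is the image of a singular point
of `f`, hence of a fold point. -/

/-- A diffeomorphism between open subsets of `ℝ³` which straightens the pair `(N, S)`: it takes `N`
to the half space and `S` to its boundary plane. -/
structure IsBoundaryChart (N S : Set Space) (Φ : OpenPartialHomeomorph Space Space) : Prop where
  contDiffOn : ContDiffOn ℝ ∞ Φ Φ.source
  contDiffOn_symm : ContDiffOn ℝ ∞ Φ.symm Φ.target
  mem_iff : ∀ x ∈ Φ.source, (x ∈ N ↔ 0 ≤ Φ x 0)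
  mem_boundary_iff : ∀ x ∈ Φ.source, (x ∈ S ↔ Φ x 0 = 0)

lemma injective_iff_surjective_euclidean {n : ℕ}
    (A : EuclideanSpace ℝ (Fin n) →L[ℝ] EuclideanSpace ℝ (Fin n)) :
    Function.Injective A ↔ Function.Surjective A :=
  LinearMap.injective_iff_surjective (f := A.toLinearMap)

/-! ### The smooth structure on a region with straightening diffeomorphisms -/

section RegionChart

variable {N S : Set Space}

lemma halfSpace_symm_val {y : Space} (hy : 0 ≤ y 0) : ((𝓡∂ 3).symm y).1 = y :=
  (𝓡∂ 3).right_inv (by rw [range_modelWithCornersEuclideanHalfSpace]; exact hy)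

open Classical in
/-- The restriction of a straightening diffeomorphism to `N`, as a chart with values in the half
space. The point `x₀` serves as a junk value of the inverse. -/
noncomputable def regionChart (x₀ : N) (Φ : OpenPartialHomeomorph Space Space)
    (h : IsBoundaryChart N S Φ) : OpenPartialHomeomorph N (EuclideanHalfSpace 3) where
  toFun y := (𝓡∂ 3).symm (Φ y.1)
  invFun z := if hz : Φ.symm z.1 ∈ N then ⟨Φ.symm z.1, hz⟩ else x₀
  source := {y | y.1 ∈ Φ.source}
  target := {z | z.1 ∈ Φ.target}
  map_source' y hy := by
    have h0 := (h.mem_iff _ hy).1 y.2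
    simp only [Set.mem_ofPred_eq] at hy ⊢
    rw [halfSpace_symm_val h0]
    exact Φ.map_source hy
  map_target' z hz := by
    have hm : Φ.symm z.1 ∈ N := by
      rw [h.mem_iff _ (Φ.map_target hz), Φ.right_inv hz]; exact z.2
    simp only [Set.mem_ofPred_eq, dif_pos hm]
    exact Φ.map_target hz
  left_inv' y hy := by
    have h0 := (h.mem_iff _ hy).1 y.2
    have hm : Φ.symm ((𝓡∂ 3).symm (Φ y.1)).1 = y.1 := by
      rw [halfSpace_symm_val h0, Φ.left_inv hy]
    have hm' : Φ.symm ((𝓡∂ 3).symm (Φ y.1)).1 ∈ N := by rw [hm]; exact y.2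
    rw [dif_pos hm']
    exact Subtype.ext hm
  right_inv' z hz := by
    have hm : Φ.symm z.1 ∈ N := by
      rw [h.mem_iff _ (Φ.map_target hz), Φ.right_inv hz]; exact z.2
    simp only [dif_pos hm]
    apply Subtype.ext
    rw [Φ.right_inv hz, halfSpace_symm_val z.2]
  open_source := Φ.open_source.preimage continuous_subtype_val
  open_target := Φ.open_target.preimage continuous_subtype_val
  continuousOn_toFun := (𝓡∂ 3).continuous_symm.comp_continuousOn
    (Φ.continuousOn.comp continuous_subtype_val.continuousOn fun _ hy => hy)
  continuousOn_invFun := by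
    rw [Topology.IsEmbedding.subtypeVal.continuousOn_iff]
    refine ContinuousOn.congr (f := fun z : EuclideanHalfSpace 3 => Φ.symm z.1)
      (Φ.symm.continuousOn.comp continuous_subtype_val.continuousOn fun _ hz => hz) ?_
    intro z hz
    have hm : Φ.symm z.1 ∈ N := by
      rw [h.mem_iff _ (Φ.map_target hz), Φ.right_inv hz]; exact z.2
    simp only [Function.comp, dif_pos hm]

variable {Φ : OpenPartialHomeomorph Space Space}

lemma mem_regionChart_source (x₀ : N) (h : IsBoundaryChart N S Φ) (y : N) :
    y ∈ (regionChart x₀ Φ h).source ↔ y.1 ∈ Φ.source := Iff.rfl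

lemma mem_regionChart_target (x₀ : N) (h : IsBoundaryChart N S Φ) (z : EuclideanHalfSpace 3) :
    z ∈ (regionChart x₀ Φ h).target ↔ z.1 ∈ Φ.target := Iff.rfl

lemma regionChart_val (x₀ : N) (h : IsBoundaryChart N S Φ) {y : N} (hy : y.1 ∈ Φ.source) :
    (regionChart x₀ Φ h y).1 = Φ y.1 :=
  halfSpace_symm_val ((h.mem_iff _ hy).1 y.2)

lemma regionChart_symm_val (x₀ : N) (h : IsBoundaryChart N S Φ) {z : EuclideanHalfSpace 3}
    (hz : z.1 ∈ Φ.target) : ((regionChart x₀ Φ h).symm z).1 = Φ.symm z.1 := by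
  have hm : Φ.symm z.1 ∈ N := by
    rw [h.mem_iff _ (Φ.map_target hz), Φ.right_inv hz]; exact z.2
  simp only [regionChart, OpenPartialHomeomorph.coe_mk_symm, PartialEquiv.coe_symm_mk, dif_pos hm]

lemma IsBoundaryChart.mem_maximalAtlas (h : IsBoundaryChart N S Φ) :
    Φ ∈ IsManifold.maximalAtlas (𝓡 3) ∞ Space := by
  rw [IsManifold.mem_maximalAtlas_iff_contMDiffOn, contMDiffOn_iff_contDiffOn,
    contMDiffOn_iff_contDiffOn]
  exact ⟨h.contDiffOn, h.contDiffOn_symm⟩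

/-- The smooth structure on a region all of whose points have straightening diffeomorphisms. -/
noncomputable abbrev regionChartedSpace
    (hN : ∀ x : N, ∃ Φ, IsBoundaryChart N S Φ ∧ x.1 ∈ Φ.source) :
    ChartedSpace (EuclideanHalfSpace 3) N where
  atlas := {e | ∃ (x₀ : N) (Φ : _) (h : IsBoundaryChart N S Φ), e = regionChart x₀ Φ h}
  chartAt x := regionChart x (hN x).choose (hN x).choose_spec.1
  mem_chart_source x := (hN x).choose_spec.2
  chart_mem_atlas x := ⟨x, _, (hN x).choose_spec.1, rfl⟩

variable (hN : ∀ x : N, ∃ Φ, IsBoundaryChart N S Φ ∧ x.1 ∈ Φ.source)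

/-- The transition maps are restrictions to the half space of the smooth maps `Ψ ∘ Φ.symm` between
open subsets of `ℝ³`. -/
lemma isManifold_region : letI := regionChartedSpace hN; IsManifold (𝓡∂ 3) ∞ N := by
  let _ := regionChartedSpace hN
  apply isManifold_of_contDiffOn
  rintro _ _ ⟨x₀, Φ, h, rfl⟩ ⟨x₁, Ψ, k, rfl⟩
  have key : ∀ y ∈ (𝓡∂ 3).symm ⁻¹' ((regionChart x₀ Φ h).symm.trans (regionChart x₁ Ψ k)).source ∩
      Set.range (𝓡∂ 3), y ∈ Φ.target ∧ Φ.symm y ∈ Ψ.source ∧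
        ((𝓡∂ 3) ∘ ((regionChart x₀ Φ h).symm.trans (regionChart x₁ Ψ k)) ∘ (𝓡∂ 3).symm) y =
          Ψ (Φ.symm y) := by
    rintro y ⟨hy, hr⟩
    rw [range_modelWithCornersEuclideanHalfSpace] at hr
    have e1 := halfSpace_symm_val hr
    simp only [Set.mem_preimage, OpenPartialHomeomorph.trans_source, Set.mem_inter_iff,
      OpenPartialHomeomorph.symm_source, mem_regionChart_source, mem_regionChart_target, e1] at hy
    have e2 := regionChart_symm_val x₀ h (z := (𝓡∂ 3).symm y) (by rw [e1]; exact hy.1)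
    rw [e1] at e2
    refine ⟨hy.1, e2 ▸ hy.2, ?_⟩
    simp only [Function.comp, OpenPartialHomeomorph.coe_trans,
      modelWithCornersEuclideanHalfSpace_toFun]
    rw [regionChart_val x₁ k hy.2, e2]
  refine ContDiffOn.congr ?_ fun y hy => (key y hy).2.2
  exact k.contDiffOn.comp (h.contDiffOn_symm.mono fun y hy => (key y hy).1)
    fun y hy => (key y hy).2.1

lemma regionChart_mem_maximalAtlas (x₀ : N) (h : IsBoundaryChart N S Φ) :
    letI := regionChartedSpace hN
    regionChart x₀ Φ h ∈ IsManifold.maximalAtlas (𝓡∂ 3) ∞ N := by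
  let _ := regionChartedSpace hN
  have := isManifold_region hN
  exact IsManifold.subset_maximalAtlas ⟨x₀, Φ, h, rfl⟩

lemma region_chartAt (x : N) :
    letI := regionChartedSpace hN
    ∃ (Φ : _) (h : IsBoundaryChart N S Φ), x.1 ∈ Φ.source ∧
      chartAt (EuclideanHalfSpace 3) x = regionChart x Φ h :=
  ⟨_, (hN x).choose_spec.1, (hN x).choose_spec.2, rfl⟩

/-- In the charts `regionChart x Φ h` and `Φ` the inclusion is the identity, so the complement in
the immersion normal form is trivial. -/
lemma isSmoothEmbedding_region_val :
    letI := regionChartedSpace hN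
    Manifold.IsSmoothEmbedding (𝓡∂ 3) (𝓡 3) ∞ (Subtype.val : N → Space) := by
  let _ := regionChartedSpace hN
  refine ⟨?_, Topology.IsEmbedding.subtypeVal⟩
  refine Manifold.IsImmersionOfComplement.isImmersion (F := PUnit) fun x => ?_
  obtain ⟨Φ, h, hx⟩ := hN x
  refine Manifold.IsImmersionAtOfComplement.mk_of_charts (.prodUnique ℝ Space PUnit)
    (regionChart x Φ h) Φ hx hx (regionChart_mem_maximalAtlas hN x h) h.mem_maximalAtlas
    (fun y hy => hy) ?_
  intro y hy
  rw [OpenPartialHomeomorph.extend_target] at hy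
  obtain ⟨hy, hr⟩ := hy
  rw [range_modelWithCornersEuclideanHalfSpace] at hr
  have e1 := halfSpace_symm_val hr
  have hy' : y ∈ Φ.target := by
    simpa only [Set.mem_preimage, mem_regionChart_target, e1] using hy
  have e2 := regionChart_symm_val x h (z := (𝓡∂ 3).symm y) (by rw [e1]; exact hy')
  rw [e1] at e2
  simp only [Function.comp, OpenPartialHomeomorph.extend_coe, OpenPartialHomeomorph.extend_coe_symm,
    modelWithCornersSelf_coe, id, e2, Φ.right_inv hy']
  rfl

lemma mem_region_boundary_iff (x : N) :
    letI := regionChartedSpace hN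
    x ∈ (𝓡∂ 3).boundary N ↔ x.1 ∈ S := by
  let _ := regionChartedSpace hN
  obtain ⟨Φ, h, hx, hc⟩ := region_chartAt hN x
  change extChartAt (𝓡∂ 3) x x ∈ frontier (Set.range (𝓡∂ 3)) ↔ _
  rw [frontier_range_modelWithCornersEuclideanHalfSpace, h.mem_boundary_iff _ hx, eq_comm]
  simp only [extChartAt, hc, Set.mem_ofPred_eq, OpenPartialHomeomorph.extend_coe,
    Function.comp, modelWithCornersEuclideanHalfSpace_toFun, regionChart_val x h hx]

/-- The extended chart at `x` is `Φ` composed with the inclusion, and its differential is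
invertible, at boundary points too. The inclusion therefore has injective differential, and the
dimensions agree. -/
lemma surjective_mfderiv_region_val (x : N) :
    letI := regionChartedSpace hN
    Function.Surjective (mfderiv (𝓡∂ 3) (𝓡 3) (Subtype.val : N → Space) x) := by
  let _ := regionChartedSpace hN
  have := isManifold_region hN
  obtain ⟨Φ, h, hx, hc⟩ := region_chartAt hN x
  have hval : MDifferentiableAt (𝓡∂ 3) (𝓡 3) (Subtype.val : N → Space) x :=
    (isSmoothEmbedding_region_val hN).contMDiff.mdifferentiableAt (by simp)
  have hΦ : MDifferentiableAt (𝓡 3) (𝓡 3) Φ x.1 :=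
    ((h.contDiffOn.contDiffAt (Φ.open_source.mem_nhds hx)).differentiableAt
      (by simp)).mdifferentiableAt
  have heq : extChartAt (𝓡∂ 3) x =ᶠ[nhds x] Φ ∘ Subtype.val := by
    filter_upwards [(Φ.open_source.preimage continuous_subtype_val).mem_nhds hx] with y hy
    simp only [extChartAt, hc, OpenPartialHomeomorph.extend_coe, Function.comp,
      modelWithCornersEuclideanHalfSpace_toFun, regionChart_val x h hy]
  have hinj : Function.Injective (mfderiv (𝓡∂ 3) (𝓡 3) (extChartAt (𝓡∂ 3) x) x) :=
    (isInvertible_mfderiv_extChartAt (mem_extChartAt_source x)).injective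
  rw [heq.mfderiv_eq, mfderiv_comp x hΦ hval] at hinj
  have hinj' : Function.Injective (mfderiv (𝓡∂ 3) (𝓡 3) (Subtype.val : N → Space) x) :=
    Function.Injective.of_comp (f := mfderiv (𝓡 3) (𝓡 3) Φ x.1) hinj
  exact (injective_iff_surjective_euclidean (n := 3) _).1 hinj'

end RegionChart

/-! ### Inverse function theorem -/


lemma exists_openPartialHomeomorph_of_injective_fderiv {g : Plane → Plane} {U : Set Plane}
    (hU : IsOpen U) (hg : ContDiffOn ℝ ∞ g U) {a : Plane} (ha : a ∈ U)
    (hinj : Function.Injective (fderiv ℝ g a)) :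
    ∃ h : OpenPartialHomeomorph Plane Plane, a ∈ h.source ∧ h.source ⊆ U ∧ (∀ x, h x = g x) ∧
      ContDiffOn ℝ ∞ h.symm h.target := by
  have hat : ∀ x ∈ U, ContDiffAt ℝ ∞ g x := fun x hx => hg.contDiffAt (hU.mem_nhds hx)
  have hcont : ContinuousOn (fderiv ℝ g) U := hg.continuousOn_fderiv_of_isOpen hU (by simp)
  let A : Plane ≃L[ℝ] Plane :=
    (LinearEquiv.ofInjectiveEndo (fderiv ℝ g a).toLinearMap hinj).toContinuousLinearEquiv
  have hA : (A : Plane →L[ℝ] Plane) = fderiv ℝ g a := by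
    ext x; rfl
  have hder : HasFDerivAt g (A : Plane →L[ℝ] Plane) a := by
    rw [hA]; exact ((hat a ha).differentiableAt (by simp)).hasFDerivAt
  -- Restricting to the points with invertible derivative makes the inverse smooth on the whole
  -- target, not only at the image of `a`.
  let V := U ∩ fderiv ℝ g ⁻¹' range ((↑) : (Plane ≃L[ℝ] Plane) → Plane →L[ℝ] Plane)
  have hV : IsOpen V := hcont.isOpen_inter_preimage hU (ContinuousLinearEquiv.isOpen)
  let h₀ := (hat a ha).toOpenPartialHomeomorph g hder (by simp)
  have hh₀ : ∀ x, h₀ x = g x := fun x => rfl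
  have hsrc : (h₀.restr V).source = h₀.source ∩ V := h₀.restr_source' V hV
  refine ⟨h₀.restr V, ?_, ?_, fun x => rfl, ?_⟩
  · rw [hsrc]
    exact ⟨(hat a ha).mem_toOpenPartialHomeomorph_source hder (by simp), ha, A, hA⟩
  · rw [hsrc]
    exact fun x hx => hx.2.1
  · intro y hy
    have hx := (h₀.restr V).map_target hy
    rw [hsrc] at hx
    obtain ⟨-, hxU, B, hB⟩ := hx
    refine ((h₀.restr V).contDiffAt_symm hy (f₀' := B) ?_ (hat _ hxU)).contDiffWithinAt
    rw [hB]
    exact ((hat _ hxU).differentiableAt (by simp)).hasFDerivAt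

/-! ### Sheet points, and twins near fold points -/

section Sheets

variable {M : Type*} [TopologicalSpace M] [ChartedSpace Plane M]

/-- `f` is a diffeomorphism of a neighbourhood of `p` onto an open set: it is a smooth chart. -/
def IsSheetPoint (f : M → Plane) (p : M) : Prop :=
  ∃ φ ∈ IsManifold.maximalAtlas (𝓡 2) ∞ M, p ∈ φ.source ∧ ∀ q ∈ φ.source, φ q = f q

variable {f : M → Plane} {p : M}

lemma contDiffOn_comp_symm_of_mem_maximalAtlas {n : ℕ} [IsManifold (𝓡 2) ∞ M]
    {g : M → EuclideanSpace ℝ (Fin n)}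
    (hg : ContMDiff (𝓡 2) (𝓡 n) ∞ g) {φ : OpenPartialHomeomorph M Plane}
    (hφ : φ ∈ IsManifold.maximalAtlas (𝓡 2) ∞ M) : ContDiffOn ℝ ∞ (g ∘ φ.symm) φ.target := by
  rw [← contMDiffOn_iff_contDiffOn]
  exact hg.comp_contMDiffOn (contMDiffOn_symm_of_mem_maximalAtlas hφ)

/-- Source and target have equal dimension, so the inverse function theorem applies to `f` read in a
chart; composing that chart with the resulting local diffeomorphism turns `f` itself into a chart.
-/
lemma isSheetPoint_of_surjective_mfderiv [IsManifold (𝓡 2) ∞ M] (hf : ContMDiff (𝓡 2) (𝓡 2) ∞ f)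
    (hp : Function.Surjective (mfderiv (𝓡 2) (𝓡 2) f p)) : IsSheetPoint f p := by
  set e := chartAt Plane p
  have he : e ∈ IsManifold.maximalAtlas (𝓡 2) ∞ M := IsManifold.chart_mem_maximalAtlas p
  have hpe : p ∈ e.source := mem_chart_source Plane p
  have hd : mfderiv (𝓡 2) (𝓡 2) f p = fderiv ℝ (f ∘ e.symm) (e p) := by
    rw [(hf.mdifferentiableAt (by simp)).mfderiv]
    simp only [mfld_simps, fderivWithin_univ]
    rfl
  have hinj : Function.Injective (fderiv ℝ (f ∘ e.symm) (e p)) := by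
    rw [← hd]
    exact (injective_iff_surjective_euclidean (n := 2) _).2 hp
  obtain ⟨h, hah, hhU, hhg, hsymm⟩ := exists_openPartialHomeomorph_of_injective_fderiv e.open_target
    (contDiffOn_comp_symm_of_mem_maximalAtlas hf he) (e.map_source hpe) hinj
  have hval : ∀ q ∈ (e.trans h).source, e.trans h q = f q := by
    intro q hq
    rw [OpenPartialHomeomorph.trans_source] at hq
    simp [hhg, e.left_inv hq.1]
  refine ⟨e.trans h, ?_, by simp [hpe, hah], hval⟩
  rw [IsManifold.mem_maximalAtlas_iff_contMDiffOn]
  refine ⟨hf.contMDiffOn.congr hval, ?_⟩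
  rw [OpenPartialHomeomorph.trans_symm_eq_symm_trans_symm, OpenPartialHomeomorph.trans_target]
  refine (contMDiffOn_symm_of_mem_maximalAtlas he).comp
    (contMDiffOn_iff_contDiffOn.2 (hsymm.mono inter_subset_left)) ?_
  intro y hy
  exact hy.2

lemma IsSheetPoint.eventually_nhds (hp : IsSheetPoint f p) : ∀ᶠ q in 𝓝 p, IsSheetPoint f q := by
  obtain ⟨φ, hφ, hpφ, h⟩ := hp
  filter_upwards [φ.open_source.mem_nhds hpφ] with q hq
  exact ⟨φ, hφ, hq, h⟩

lemma IsSheetPoint.exists_injOn (hp : IsSheetPoint f p) : ∃ U ∈ 𝓝 p, InjOn f U := by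
  obtain ⟨φ, -, hpφ, h⟩ := hp
  refine ⟨φ.source, φ.open_source.mem_nhds hpφ, φ.injOn.congr h⟩

lemma IsSheetPoint.image_mem_nhds (hp : IsSheetPoint f p) {U : Set M} (hU : U ∈ 𝓝 p) :
    f '' U ∈ 𝓝 (f p) := by
  obtain ⟨φ, -, hpφ, h⟩ := hp
  have := φ.image_mem_nhds hpφ (inter_mem hU (φ.open_source.mem_nhds hpφ))
  rw [h p hpφ] at this
  refine mem_of_superset this ?_
  rintro _ ⟨q, ⟨hq, hq'⟩, rfl⟩
  exact ⟨q, hq, (h q hq').symm⟩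

/-! ### Fold points -/

/-- The reflection `(u, v) ↦ (u, -v)` of the plane. -/
noncomputable def flipSnd (y : Plane) : Plane := !₂[y 0, -y 1]

lemma norm_flipSnd (y : Plane) : ‖flipSnd y‖ = ‖y‖ := by
  simp [flipSnd, EuclideanSpace.norm_eq, Fin.sum_univ_two]

lemma flipSnd_ne {y : Plane} (hy : y 1 ≠ 0) : flipSnd y ≠ y := by
  intro h
  have := congrArg (fun z : Plane => z 1) h
  simp [flipSnd] at this
  exact hy (by linarith)

end Sheets

section FoldChart

variable {M : Type*} [TopologicalSpace M] {f : M → Plane}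
  {φ : OpenPartialHomeomorph M Plane} {ψ : OpenPartialHomeomorph Plane Plane}

lemma eq_of_fold_chart
    (h : ∀ q ∈ φ.source, f q ∈ ψ.source ∧ ψ (f q) = !₂[φ q 0, (φ q 1) ^ 2])
    {a b : M} (ha : a ∈ φ.source) (hb : b ∈ φ.source)
    (h0 : φ a 0 = φ b 0) (h1 : φ a 1 ^ 2 = φ b 1 ^ 2) : f a = f b :=
  ψ.injOn (h a ha).1 (h b hb).1 (by rw [(h a ha).2, (h b hb).2, h0, h1])

lemma apply_symm_flipSnd
    (h : ∀ q ∈ φ.source, f q ∈ ψ.source ∧ ψ (f q) = !₂[φ q 0, (φ q 1) ^ 2])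
    {y : Plane} (hy : y ∈ φ.target) (hy' : flipSnd y ∈ φ.target) :
    f (φ.symm (flipSnd y)) = f (φ.symm y) :=
  eq_of_fold_chart h (φ.map_target hy') (φ.map_target hy)
    (by rw [φ.right_inv hy, φ.right_inv hy']; simp [flipSnd])
    (by rw [φ.right_inv hy, φ.right_inv hy']; simp [flipSnd])

/-- Points on the fold line of a fold chart have arbitrarily small pairs of points with the same
image. -/
lemma exists_pair_of_fold_chart
    (h : ∀ q ∈ φ.source, f q ∈ ψ.source ∧ ψ (f q) = !₂[φ q 0, (φ q 1) ^ 2])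
    {a : M} (ha : a ∈ φ.source) (ha1 : φ a 1 = 0) {W : Set M}
    (hW : W ∈ 𝓝 a) : ∃ b ∈ W, ∃ c ∈ W, b ≠ c ∧ f b = f c := by
  have hT : φ.target ∩ φ.symm ⁻¹' W ∈ 𝓝 (φ a) := by
    refine inter_mem (φ.open_target.mem_nhds (φ.map_source ha)) ?_
    exact (φ.continuousAt_symm (φ.map_source ha)).preimage_mem_nhds (by rwa [φ.left_inv ha])
  let l : ℝ → Plane := fun t => !₂[φ a 0, t]
  have hl : Continuous l := by
    refine (PiLp.continuous_toLp 2 _).comp (continuous_pi fun i => ?_)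
    fin_cases i
    · exact continuous_const
    · exact continuous_id
  have hl0 : l 0 = φ a := by
    ext i; fin_cases i
    · rfl
    · exact ha1.symm
  have hev : ∀ᶠ t in 𝓝 (0 : ℝ), l t ∈ φ.target ∩ φ.symm ⁻¹' W :=
    hl.continuousAt.preimage_mem_nhds (by rwa [hl0])
  have hev' : ∀ᶠ t in 𝓝 (0 : ℝ), l (-t) ∈ φ.target ∩ φ.symm ⁻¹' W :=
    (show Tendsto (fun t : ℝ => -t) (𝓝 0) (𝓝 0) by simpa using tendsto_neg (0 : ℝ)).eventually hev
  obtain ⟨t, ⟨ht, ht'⟩, h0⟩ := (((hev.and hev').filter_mono nhdsWithin_le_nhds).and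
    (self_mem_nhdsWithin : _ ∈ 𝓝[>] (0 : ℝ))).exists
  have hflip : flipSnd (l t) = l (-t) := by
    ext i; fin_cases i <;> simp [flipSnd, l]
  refine ⟨_, ht'.2, _, ht.2, ?_, ?_⟩
  · intro heq
    have := φ.symm.injOn ht'.1 ht.1 heq
    have := congrArg (fun z : Plane => z 1) this
    simp only [l] at this
    have h0' : (0 : ℝ) < t := h0
    simp at this
    linarith
  · rw [← hflip] at ht' ⊢
    exact apply_symm_flipSnd h ht.1 ht'.1

/-- The points `(u, t)` and `(u, -t)` have the same image, so `f` is not locally injective on the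
fold line. -/
lemma not_isSheetPoint_of_fold_chart [ChartedSpace Plane M]
    (h : ∀ q ∈ φ.source, f q ∈ ψ.source ∧ ψ (f q) = !₂[φ q 0, (φ q 1) ^ 2])
    {a : M} (ha : a ∈ φ.source) (ha1 : φ a 1 = 0) :
    ¬ IsSheetPoint f a := by
  intro hs
  obtain ⟨U, hU, hinj⟩ := hs.exists_injOn
  obtain ⟨b, hb, c, hc, hbc, hfbc⟩ := exists_pair_of_fold_chart h ha ha1 hU
  exact hbc (hinj hb hc hfbc)

end FoldChart

section FoldPoints

variable {M : Type*} [TopologicalSpace M] [ChartedSpace Plane M] {f : M → Plane} {p : M}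

lemma IsFoldPoint.exists_pair (hp : IsFoldPoint f p) {W : Set M} (hW : W ∈ 𝓝 p) :
    ∃ b ∈ W, ∃ c ∈ W, b ≠ c ∧ f b = f c := by
  obtain ⟨φ, -, ψ, -, hpφ, h0, h⟩ := hp
  exact exists_pair_of_fold_chart h hpφ (by simp [h0]) hW

/-- A fold point has arbitrarily small neighbourhoods in which every sheet point has a twin. -/
lemma IsFoldPoint.exists_twin (hp : IsFoldPoint f p) {U : Set M} (hU : U ∈ 𝓝 p) :
    ∃ V ∈ 𝓝 p, V ⊆ U ∧ ∀ a ∈ V, IsSheetPoint f a → ∃ b ∈ V, b ≠ a ∧ f b = f a := by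
  obtain ⟨φ, -, ψ, -, hpφ, h0, h⟩ := hp
  have hT : φ.target ∩ φ.symm ⁻¹' U ∈ 𝓝 (0 : Plane) := by
    rw [← h0]
    refine inter_mem (φ.open_target.mem_nhds (φ.map_source hpφ)) ?_
    exact (φ.continuousAt_symm (φ.map_source hpφ)).preimage_mem_nhds (by rwa [φ.left_inv hpφ])
  obtain ⟨ε, hε, hball⟩ := Metric.mem_nhds_iff.1 hT
  refine ⟨φ.source ∩ φ ⁻¹' Metric.ball 0 ε, ?_, ?_, ?_⟩
  · refine (φ.isOpen_inter_preimage Metric.isOpen_ball).mem_nhds ⟨hpφ, ?_⟩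
    simpa [h0] using hε
  · rintro a ⟨ha, ha'⟩
    simpa [φ.left_inv ha] using (hball ha').2
  · rintro a ⟨ha, ha'⟩ hs
    have ha1 : φ a 1 ≠ 0 := fun h1 => not_isSheetPoint_of_fold_chart h ha h1 hs
    have hflip : flipSnd (φ a) ∈ Metric.ball (0 : Plane) ε := by
      simpa [norm_flipSnd] using ha'
    have ht := (hball hflip).1
    refine ⟨φ.symm (flipSnd (φ a)), ⟨φ.map_target ht, ?_⟩, ?_, ?_⟩
    · rw [mem_preimage, φ.right_inv ht]; exact hflip
    · intro heq
      apply flipSnd_ne ha1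
      rw [← φ.right_inv ht, heq]
    · rw [apply_symm_flipSnd h (φ.map_source ha) ht, φ.left_inv ha]

end FoldPoints

/-! ### The union of vertical segments: compactness, connectedness, openness off the surface -/

section TwoSheeted

variable {M : Type*} [TopologicalSpace M] [ChartedSpace Plane M]

/-- The topological data of an embedding lift of a fold map with at most two points in each
fibre. -/
structure IsTwoSheetedLift (f : M → Plane) (η : M → Space) : Prop where
  continuous_map : Continuous f
  continuous_lift : Continuous η
  injective_lift : Function.Injective η
  lift : ∀ x, stdProj (η x) = f x
  fold : ∀ p, ¬ IsSheetPoint f p → IsFoldPoint f p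
  card : ∀ a b c, f a = f b → f a = f c → a = b ∨ a = c ∨ b = c

lemma stdProj_continuous : Continuous stdProj := by
  refine (PiLp.continuous_toLp 2 _).comp (continuous_pi fun i => ?_)
  fin_cases i <;> simp <;> fun_prop

@[simp] lemma stdProj_zero (x : Space) : stdProj x 0 = x 0 := rfl

@[simp] lemma stdProj_one (x : Space) : stdProj x 1 = x 1 := rfl

lemma space_ext {x y : Space} (h : stdProj x = stdProj y) (h2 : x 2 = y 2) : x = y := by
  ext i
  fin_cases i
  · exact congrArg (fun z : Plane => z 0) h
  · exact congrArg (fun z : Plane => z 1) h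
  · exact h2

/-- A segment with ends on the same vertical line. -/
lemma mem_segment_iff_of_stdProj_eq {x y z : Space} (h : stdProj x = stdProj y) :
    z ∈ segment ℝ x y ↔ stdProj z = stdProj x ∧ z 2 ∈ uIcc (x 2) (y 2) := by
  have h0 : x 0 = y 0 := congrArg (fun z : Plane => z 0) h
  have h1 : x 1 = y 1 := congrArg (fun z : Plane => z 1) h
  rw [← segment_eq_uIcc, segment_eq_image, segment_eq_image]
  constructor
  · rintro ⟨t, ht, rfl⟩
    refine ⟨?_, t, ht, by simp⟩
    ext i; fin_cases i
    · simp [← h0]; ring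
    · simp [← h1]; ring
  · rintro ⟨hz, t, ht, hzt⟩
    refine ⟨t, ht, space_ext ?_ ?_⟩
    · rw [hz]
      ext i; fin_cases i
      · simp [← h0]; ring
      · simp [← h1]; ring
    · simpa using hzt

/-- The pairs of points in the same fibre which are either equal or sheet points. -/
def sheetPairs (f : M → Plane) : Set (M × M) :=
  {x | f x.1 = f x.2 ∧ (x.1 = x.2 ∨ IsSheetPoint f x.1)}

/-- The union of the vertical segments spanned by the pairs of points of `K` in `sheetPairs f`. -/
def sheetRegion (f : M → Plane) (η : M → Space) (K : Set M) : Set Space :=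
  {x | ∃ p ∈ K, ∃ q ∈ K, (p, q) ∈ sheetPairs f ∧ x ∈ segment ℝ (η p) (η q)}

variable {f : M → Plane} {η : M → Space}

lemma mem_sheetRegion_of_mem {K : Set M} {p : M} (hp : p ∈ K) : η p ∈ sheetRegion f η K :=
  ⟨p, hp, p, hp, ⟨rfl, Or.inl rfl⟩, left_mem_segment ℝ _ _⟩

namespace IsTwoSheetedLift

lemma mem_segment_iff (H : IsTwoSheetedLift f η) {p q : M} (h : f p = f q) {x : Space} :
    x ∈ segment ℝ (η p) (η q) ↔ stdProj x = f p ∧ x 2 ∈ uIcc (η p 2) (η q 2) := by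
  rw [mem_segment_iff_of_stdProj_eq (by rw [H.lift, H.lift, h]), H.lift]

lemma eq_of_height_eq (H : IsTwoSheetedLift f η)
    {p q : M} (h : f p = f q) (h2 : η p 2 = η q 2) : p = q :=
  H.injective_lift (space_ext (by rw [H.lift, H.lift, h]) h2)

/-- If `q` were a sheet point, the values near `f q` would all be taken near `q`. A pair with common
value near the fold point `p` would then have a third companion near `q`. -/
lemma not_isSheetPoint_of_fiber (H : IsTwoSheetedLift f η)
    [T2Space M] {p q : M} (hne : p ≠ q) (hfpq : f p = f q)
    (hp : ¬ IsSheetPoint f p) : ¬ IsSheetPoint f q := by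
  intro hq
  obtain ⟨U, V, hU, hV, hUV⟩ := t2_separation_nhds hne
  have hW : U ∩ f ⁻¹' (f '' V) ∈ 𝓝 p :=
    inter_mem hU (H.continuous_map.continuousAt.preimage_mem_nhds
      (by rw [hfpq]; exact hq.image_mem_nhds hV))
  obtain ⟨b, ⟨hb, hb'⟩, c, ⟨hc, -⟩, hbc, hfbc⟩ := (H.fold p hp).exists_pair hW
  obtain ⟨d, hd, hdb⟩ := hb'
  have hbd : b ≠ d := fun h => disjoint_left.1 hUV hb (h ▸ hd)
  have hcd : c ≠ d := fun h => disjoint_left.1 hUV hc (h ▸ hd)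
  rcases H.card b c d hfbc hdb.symm with h | h | h <;> contradiction

lemma isSheetPoint_of_fiber (H : IsTwoSheetedLift f η) [T2Space M] {p q : M} (hfpq : f p = f q)
    (hp : IsSheetPoint f p) : IsSheetPoint f q := by
  by_contra hq
  rcases eq_or_ne q p with rfl | hne
  · exact hq hp
  · exact H.not_isSheetPoint_of_fiber hne hfpq.symm hq hp

/-- A limit of such pairs could fail only at `p ≠ q` with `p` a fold point. But a nearby sheet point
`a` has a twin `c` near `p`, so a partner `b` near `q` would be a third point of the fibre. -/
lemma isClosed_sheetPairs (H : IsTwoSheetedLift f η) [T2Space M] : IsClosed (sheetPairs f) := by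
  rw [← isOpen_compl_iff, isOpen_iff_mem_nhds]
  rintro ⟨p, q⟩ hpq
  by_cases hfpq : f p = f q
  · have hne : p ≠ q := fun h => hpq ⟨hfpq, Or.inl h⟩
    have hp : ¬ IsSheetPoint f p := fun h => hpq ⟨hfpq, Or.inr h⟩
    obtain ⟨U, V, hU, hV, hUV⟩ := t2_separation_nhds hne
    obtain ⟨U', hU', hUU', htwin⟩ := (H.fold p hp).exists_twin hU
    filter_upwards [prod_mem_nhds hU' hV]
    rintro ⟨a, b⟩ ⟨ha, hb⟩ ⟨hab, hor⟩
    have hab' : a ≠ b := fun h => disjoint_left.1 hUV (hUU' ha) (h ▸ hb)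
    obtain ⟨c, hc, hca, hfca⟩ := htwin a ha (hor.resolve_left hab')
    have hcb : c ≠ b := fun h => disjoint_left.1 hUV (hUU' hc) (h ▸ hb)
    rcases H.card c a b hfca (hfca.trans hab) with h | h | h <;> contradiction
  · have : IsOpen {x : M × M | f x.1 ≠ f x.2} :=
      isOpen_ne_fun (H.continuous_map.comp continuous_fst) (H.continuous_map.comp continuous_snd)
    filter_upwards [this.mem_nhds (show (p, q) ∈ _ from hfpq)] with x hx h
    exact hx h.1

lemma isCompact_sheetRegion (H : IsTwoSheetedLift f η)
    [T2Space M] [CompactSpace M] {K : Set M} (hK : IsClosed K) :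
    IsCompact (sheetRegion f η K) := by
  have hD : IsCompact (sheetPairs f ∩ K ×ˢ K) :=
    (H.isClosed_sheetPairs.inter (hK.prod hK)).isCompact
  have hc : Continuous fun x : (M × M) × ℝ => (1 - x.2) • η x.1.1 + x.2 • η x.1.2 := by
    have := H.continuous_lift
    fun_prop
  convert (hD.prod (isCompact_Icc (a := (0 : ℝ)) (b := 1))).image hc using 1
  ext x
  constructor
  · rintro ⟨p, hp, q, hq, hpq, hx⟩
    rw [segment_eq_image] at hx
    obtain ⟨t, ht, rfl⟩ := hx
    exact ⟨((p, q), t), ⟨⟨hpq, hp, hq⟩, ht⟩, rfl⟩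
  · rintro ⟨⟨⟨p, q⟩, t⟩, ⟨⟨hpq, hp, hq⟩, ht⟩, rfl⟩
    refine ⟨p, hp, q, hq, hpq, ?_⟩
    rw [segment_eq_image]
    exact ⟨t, ht, rfl⟩

/-- Every segment is attached to the connected surface `η(M)` at its ends. -/
lemma isConnected_sheetRegion (H : IsTwoSheetedLift f η)
    [ConnectedSpace M] : IsConnected (sheetRegion f η univ) := by
  obtain ⟨p₀⟩ := (inferInstance : Nonempty M)
  refine ⟨⟨η p₀, mem_sheetRegion_of_mem (mem_univ _)⟩, ?_⟩
  refine isPreconnected_of_forall (η p₀) ?_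
  rintro x ⟨p, -, q, -, hpq, hx⟩
  refine ⟨range η ∪ segment ℝ (η p) (η q), ?_, Or.inl ⟨p₀, rfl⟩, Or.inr hx, ?_⟩
  · rintro y (⟨r, rfl⟩ | hy)
    · exact mem_sheetRegion_of_mem (mem_univ _)
    · exact ⟨p, mem_univ _, q, mem_univ _, hpq, hy⟩
  · exact (isPreconnected_range H.continuous_lift).union (η p) ⟨p, rfl⟩ (left_mem_segment ℝ _ _)
      (convex_segment _ _).isPreconnected

/-- Off the surface the spanning segment is nondegenerate, which forces both ends to be sheet points
and `x` to lie strictly between them. -/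
lemma exists_lt_lt_of_mem_sheetRegion (H : IsTwoSheetedLift f η) [T2Space M] {K : Set M} {x : Space}
    (hx : x ∈ sheetRegion f η K)
    (hxS : x ∉ range η) : ∃ p ∈ K, ∃ q ∈ K, IsSheetPoint f p ∧ IsSheetPoint f q ∧ f p = stdProj x ∧
      f q = stdProj x ∧ η p 2 < x 2 ∧ x 2 < η q 2 := by
  obtain ⟨p, hp, q, hq, ⟨hfpq, hor⟩, hseg⟩ := hx
  have hseg' := (H.mem_segment_iff hfpq).1 hseg
  have hp2 : η p 2 ≠ x 2 := fun h => hxS ⟨p, space_ext (by rw [H.lift, hseg'.1]) h⟩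
  have hq2 : η q 2 ≠ x 2 := fun h => hxS ⟨q, space_ext (by rw [H.lift, hseg'.1]; exact hfpq.symm) h⟩
  have hne : p ≠ q := by
    rintro rfl
    have := hseg'.2
    rw [uIcc_self] at this
    exact hp2 this.symm
  have hps := hor.resolve_left hne
  have hqs := H.isSheetPoint_of_fiber hfpq hps
  rcases mem_uIcc.1 hseg'.2 with ⟨h1, h2⟩ | ⟨h1, h2⟩
  · exact ⟨p, hp, q, hq, hps, hqs, hseg'.1.symm, hfpq ▸ hseg'.1.symm, lt_of_le_of_ne h1 hp2,
      lt_of_le_of_ne h2 hq2.symm⟩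
  · exact ⟨q, hq, p, hp, hqs, hps, hfpq ▸ hseg'.1.symm, hseg'.1.symm, lt_of_le_of_ne h1 hq2,
      lt_of_le_of_ne h2 hp2.symm⟩

lemma mem_sheetRegion_of_le (H : IsTwoSheetedLift f η)
    {p q : M} {K : Set M} (hp : p ∈ K) (hq : q ∈ K)
    (hs : IsSheetPoint f p) {x : Space}
    (hpx : f p = stdProj x) (hqx : f q = stdProj x) (h : x 2 ∈ uIcc (η p 2) (η q 2)) :
    x ∈ sheetRegion f η K :=
  ⟨p, hp, q, hq, ⟨hpx.trans hqx.symm, Or.inr hs⟩,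
    (H.mem_segment_iff (hpx.trans hqx.symm)).2 ⟨hpx.symm, h⟩⟩

/-- The sheets through the two ends cover all nearby vertical lines and stay below, respectively
above, the nearby points. Having two points already, the fibre has none left to meet such a point.
-/
lemma isOpen_sheetRegion_diff (H : IsTwoSheetedLift f η)
    [T2Space M] : IsOpen (sheetRegion f η univ \ range η) := by
  rw [isOpen_iff_mem_nhds]
  rintro x ⟨hx, hxS⟩
  obtain ⟨p, -, q, -, hps, hqs, hfp, hfq, h1, h2⟩ := H.exists_lt_lt_of_mem_sheetRegion hx hxS
  obtain ⟨c, hc1, hc2⟩ := exists_between h1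
  obtain ⟨d, hd1, hd2⟩ := exists_between h2
  have h2c : Continuous fun m => η m 2 := by
    have := H.continuous_lift
    fun_prop
  have hU : {m | IsSheetPoint f m ∧ η m 2 < c} ∈ 𝓝 p :=
    hps.eventually_nhds.and ((isOpen_lt h2c continuous_const).mem_nhds hc1)
  have hV : {m | d < η m 2} ∈ 𝓝 q := (isOpen_lt continuous_const h2c).mem_nhds hd2
  have hy2 : Continuous fun y : Space => y 2 := by fun_prop
  have hx2 : ∀ᶠ y : Space in 𝓝 x, c < y 2 ∧ y 2 < d :=
    (hy2.continuousAt.eventually (lt_mem_nhds hc2)).and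
      (hy2.continuousAt.eventually (gt_mem_nhds hd1))
  filter_upwards [hx2, stdProj_continuous.continuousAt.preimage_mem_nhds
    (hfp ▸ hps.image_mem_nhds hU), stdProj_continuous.continuousAt.preimage_mem_nhds
    (hfq ▸ hqs.image_mem_nhds hV)]
  rintro y ⟨hy1, hy2⟩ ⟨a, ⟨has, ha⟩, hfa⟩ ⟨b, hb, hfb⟩
  have ha' : η a 2 < y 2 := ha.trans hy1
  have hb' : y 2 < η b 2 := hy2.trans hb
  refine ⟨H.mem_sheetRegion_of_le (mem_univ a) (mem_univ b) has hfa hfb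
    (mem_uIcc.2 (Or.inl ⟨ha'.le, hb'.le⟩)), ?_⟩
  rintro ⟨m, rfl⟩
  rw [H.lift] at hfa hfb
  rcases H.card m a b hfa.symm hfb.symm with rfl | rfl | rfl
  · exact lt_irrefl _ ha'
  · exact lt_irrefl _ hb'
  · exact lt_asymm ha' hb'

/-- No fibre consists of a single sheet point. -/
lemma exists_ne_of_isSheetPoint (H : IsTwoSheetedLift f η)
    [T2Space M] [CompactSpace M] {p : M} (hp : IsSheetPoint f p) :
    ∃ q, q ≠ p ∧ f q = f p := by
  by_contra! hcon
  -- The values whose fibre is a single sheet point. This set is shown to be open and closed; if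
  -- nonempty it would be the whole plane, while it is contained in the bounded set `range f`.
  let R : Set Plane := {r | ∃ p, IsSheetPoint f p ∧ f p = r ∧ ∀ q, f q = r → q = p}
  have hclosedMap : IsClosedMap f := H.continuous_map.isClosedMap
  -- fibres over nearby values stay close to the fibre
  have hprop : ∀ (r : Plane) (U : Set M), (∀ q, f q = r → U ∈ 𝓝 q) →
      ∀ᶠ r' in 𝓝 r, ∀ q, f q = r' → q ∈ U := by
    intro r U hU
    have hcl : IsClosed (f '' (interior U)ᶜ) := hclosedMap _ isOpen_interior.isClosed_compl
    have : (f '' (interior U)ᶜ)ᶜ ∈ 𝓝 r := by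
      refine hcl.isOpen_compl.mem_nhds ?_
      rintro ⟨q, hq, hqr⟩
      exact hq (mem_interior_iff_mem_nhds.2 (hU q hqr))
    filter_upwards [this] with r' hr' q hq
    by_contra hqU
    exact hr' ⟨q, fun h => hqU (interior_subset h), hq⟩
  have hopen : IsOpen R := by
    rw [isOpen_iff_mem_nhds]
    rintro r ⟨a, ha, rfl, huniq⟩
    obtain ⟨U, hU, hinj⟩ := ha.exists_injOn
    have hU' : U ∩ {m | IsSheetPoint f m} ∈ 𝓝 a := inter_mem hU ha.eventually_nhds
    filter_upwards [ha.image_mem_nhds hU', hprop (f a) U fun q hq => huniq q hq ▸ hU]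
    rintro _ ⟨b, hb, rfl⟩ hr
    exact ⟨b, hb.2, rfl, fun q hq => hinj (hr q hq) hb.1 hq⟩
  have hclosed : IsClosed R := by
    rw [← isOpen_compl_iff, isOpen_iff_mem_nhds]
    intro r hr
    -- Over a value outside `R` there are either two distinct sheets, which persist over nearby
    -- values, or only fold points, near which each sheet point has a twin.
    by_cases hs : ∃ a, f a = r ∧ IsSheetPoint f a
    · obtain ⟨a, rfl, ha⟩ := hs
      obtain ⟨b, hfb, hba⟩ : ∃ b, f b = f a ∧ b ≠ a := by
        by_contra! h
        exact hr ⟨a, ha, rfl, h⟩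
      have hb := H.isSheetPoint_of_fiber hfb.symm ha
      obtain ⟨U, V, hU, hV, hUV⟩ := t2_separation_nhds hba
      filter_upwards [hfb ▸ hb.image_mem_nhds hU, ha.image_mem_nhds hV]
      rintro r' ⟨c, hc, hfc⟩ ⟨d, hd, hfd⟩ ⟨e, -, -, huniq⟩
      have hcd : c = d := (huniq c hfc).trans (huniq d hfd).symm
      exact disjoint_left.1 hUV hc (hcd ▸ hd)
    · push Not at hs
      have htw : ∀ a, f a = r → ∃ V ∈ 𝓝 a,
          ∀ m ∈ V, IsSheetPoint f m → ∃ b, b ≠ m ∧ f b = f m := by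
        intro a ha
        obtain ⟨V, hV, -, htwin⟩ := (H.fold a (hs a ha)).exists_twin univ_mem
        exact ⟨V, hV, fun m hm hms => (htwin m hm hms).imp fun b hb => hb.2⟩
      filter_upwards [hprop r {m | IsSheetPoint f m → ∃ b, b ≠ m ∧ f b = f m} (by
        intro q hq
        obtain ⟨V, hV, hV'⟩ := htw q hq
        exact mem_of_superset hV hV')]
      rintro r' hr' ⟨a, ha, hfa, huniq⟩
      obtain ⟨b, hb, hfb⟩ := hr' a hfa ha
      exact hb (huniq b (hfb.trans hfa))
  have hne : R.Nonempty := ⟨f p, p, hp, rfl, fun q hq => by_contra fun h => hcon q h hq⟩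
  have huniv : R = univ := IsClopen.eq_univ ⟨hclosed, hopen⟩ hne
  have hbdd : Bornology.IsBounded (range f) := (isCompact_range H.continuous_map).isBounded
  have hR : R ⊆ range f := by
    rintro r ⟨a, -, rfl, -⟩
    exact ⟨a, rfl⟩
  rw [huniv] at hR
  exact NormedSpace.unbounded_univ ℝ Plane (hbdd.subset hR)

end IsTwoSheetedLift

end TwoSheeted

/-! ### Identification of the bounded region with the union of segments -/

section BoundedRegion

/-- The point at height `t` on the vertical line over `r`. -/
noncomputable def atHeight (r : Plane) (t : ℝ) : Space := !₂[r 0, r 1, t]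

@[simp] lemma stdProj_atHeight (r : Plane) (t : ℝ) : stdProj (atHeight r t) = r := by
  ext i; fin_cases i <;> simp [stdProj, atHeight]

@[simp] lemma atHeight_two (r : Plane) (t : ℝ) : atHeight r t 2 = t := rfl

lemma atHeight_stdProj (x : Space) : atHeight (stdProj x) (x 2) = x :=
  space_ext (by simp) (by simp)

lemma continuous_atHeight : Continuous fun x : Plane × ℝ => atHeight x.1 x.2 := by
  refine (PiLp.continuous_toLp 2 _).comp (continuous_pi fun i => ?_)
  fin_cases i <;> simp <;> fun_prop

/-- A vertical ray starting near `x` and missing `S` makes the component of `x`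
in the complement unbounded. -/
lemma not_isBounded_connectedComponentIn_of_ray {S : Set Space} {x : Space} {δ : ℝ}
    (hδ : Metric.ball x δ ⊆ Sᶜ) {y : Space} (hy : y ∈ Metric.ball x δ) {I : Set ℝ}
    (hI : IsPreconnected I) (hyI : y 2 ∈ I) (hub : ¬ Bornology.IsBounded I)
    (hray : ∀ t ∈ I, atHeight (stdProj y) t ∉ S) :
    ¬ Bornology.IsBounded (connectedComponentIn Sᶜ x) := by
  intro hb
  have hc : Continuous fun t => atHeight (stdProj y) t :=
    continuous_atHeight.comp (continuous_const.prodMk continuous_id)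
  have hpos : 0 < δ := lt_of_le_of_lt dist_nonneg hy
  have hpre : IsPreconnected (Metric.ball x δ ∪ (fun t => atHeight (stdProj y) t) '' I) :=
    (convex_ball x δ).isPreconnected.union y hy ⟨y 2, hyI, atHeight_stdProj y⟩
      (hI.image _ hc.continuousOn)
  have hsub := hpre.subset_connectedComponentIn (x := x) (F := Sᶜ)
    (Or.inl (Metric.mem_ball_self hpos)) (by
      rintro z (hz | ⟨t, ht, rfl⟩)
      · exact hδ hz
      · exact hray t ht)
  obtain ⟨C, hC⟩ := hb.exists_norm_le
  refine hub (isBounded_iff_forall_norm_le.2 ⟨C, fun t ht => ?_⟩)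
  calc ‖t‖ = ‖atHeight (stdProj y) t 2‖ := by simp
    _ ≤ ‖atHeight (stdProj y) t‖ := PiLp.norm_apply_le _ _
    _ ≤ C := hC _ (hsub (Or.inr ⟨t, ht, rfl⟩))

lemma not_isBounded_Ici (a : ℝ) : ¬ Bornology.IsBounded (Ici a) := fun h =>
  not_bddAbove_Ici a h.bddAbove

lemma not_isBounded_Iic (a : ℝ) : ¬ Bornology.IsBounded (Iic a) := fun h =>
  not_bddBelow_Iic a h.bddBelow

variable {M : Type*} [TopologicalSpace M] [ChartedSpace Plane M] {f : M → Plane} {η : M → Space}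

namespace IsTwoSheetedLift

lemma atHeight_notMem_range (H : IsTwoSheetedLift f η)
    {r : Plane} {t : ℝ} (h : ∀ m, f m = r → η m 2 ≠ t) :
    atHeight r t ∉ range η := by
  rintro ⟨m, hm⟩
  exact h m (by rw [← H.lift, hm, stdProj_atHeight]) (by rw [hm, atHeight_two])

/-- Otherwise neither vertical ray from a point near `x` could miss the surface, so the fibre has
points below and above `x`. The lower one `p` must be a fold point. A pair near `p` exhausts its
fibre and lies below the height of `x`, so the upward ray from a point near `x` over that fibre is
free. -/
lemma mem_sheetRegion_of_isBounded (H : IsTwoSheetedLift f η)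
    [T2Space M] [CompactSpace M] {x : Space} (hx : x ∉ range η)
    (hb : Bornology.IsBounded (connectedComponentIn (range η)ᶜ x)) :
    x ∈ sheetRegion f η univ := by
  by_contra hxN
  have hcl : IsClosed (range η) := (isCompact_range H.continuous_lift).isClosed
  obtain ⟨δ, hδ, hball⟩ := Metric.isOpen_iff.1 hcl.isOpen_compl x hx
  have hdown : ∀ y ∈ Metric.ball x δ, ¬ ∀ m, f m = stdProj y → y 2 < η m 2 := by
    intro y hy h
    exact not_isBounded_connectedComponentIn_of_ray hball hy isPreconnected_Iic
      self_mem_Iic (not_isBounded_Iic _)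
      (fun t ht => H.atHeight_notMem_range fun m hm => ((mem_Iic.1 ht).trans_lt (h m hm)).ne') hb
  have hup : ∀ y ∈ Metric.ball x δ, ¬ ∀ m, f m = stdProj y → η m 2 < y 2 := by
    intro y hy h
    exact not_isBounded_connectedComponentIn_of_ray hball hy isPreconnected_Ici
      self_mem_Ici (not_isBounded_Ici _)
      (fun t ht => H.atHeight_notMem_range fun m hm => ((h m hm).trans_le (mem_Ici.1 ht)).ne) hb
  have h1 := hdown x (Metric.mem_ball_self hδ)
  have h2 := hup x (Metric.mem_ball_self hδ)
  push Not at h1 h2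
  obtain ⟨p, hfp, hp⟩ := h1
  obtain ⟨q, hfq, hq⟩ := h2
  have hp' : η p 2 < x 2 := lt_of_le_of_ne hp fun h =>
    hx ⟨p, space_ext (by rw [H.lift, hfp]) h⟩
  have hps : ¬ IsSheetPoint f p := fun hs => hxN
    (H.mem_sheetRegion_of_le (mem_univ p) (mem_univ q) hs hfp hfq (mem_uIcc.2 (Or.inl ⟨hp, hq⟩)))
  have h2c : Continuous fun m => η m 2 := by
    have := H.continuous_lift
    fun_prop
  have hc : Continuous fun r => atHeight r (x 2) :=
    continuous_atHeight.comp (continuous_id.prodMk continuous_const)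
  have hW : {m | η m 2 < x 2 ∧ atHeight (f m) (x 2) ∈ Metric.ball x δ} ∈ 𝓝 p := by
    refine (h2c.continuousAt.eventually (gt_mem_nhds hp')).and ?_
    refine (hc.comp H.continuous_map).continuousAt.preimage_mem_nhds
      (Metric.isOpen_ball.mem_nhds ?_)
    rw [Function.comp, hfp, atHeight_stdProj]
    exact Metric.mem_ball_self hδ
  obtain ⟨a, ⟨ha, hab⟩, b, ⟨hb', -⟩, hne, hfab⟩ := (H.fold p hps).exists_pair hW
  refine hup _ hab fun m hm => ?_
  rw [stdProj_atHeight] at hm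
  rw [atHeight_two]
  rcases H.card a b m hfab hm.symm with h | rfl | rfl
  · exact absurd h hne
  · exact ha
  · exact hb'

/-- The inclusion from right to left is topological: off the surface, the union of segments is open
and its complement is open, so a component that meets it stays inside this compact set. -/
lemma boundedRegion_eq (H : IsTwoSheetedLift f η) [T2Space M] [CompactSpace M] :
    boundedRegion (range η) = sheetRegion f η univ := by
  ext x
  constructor
  · rintro (⟨m, rfl⟩ | ⟨hx, hb⟩)
    · exact mem_sheetRegion_of_mem (mem_univ _)
    · exact H.mem_sheetRegion_of_isBounded hx hb
  · intro hx
    by_cases hxS : x ∈ range η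
    · exact Or.inl hxS
    refine Or.inr ⟨hxS, ?_⟩
    have hK := H.isCompact_sheetRegion isClosed_univ
    refine hK.isBounded.subset ?_
    have hsub : connectedComponentIn (range η)ᶜ x ⊆ sheetRegion f η univ \ range η := by
      refine isPreconnected_connectedComponentIn.subset_left_of_subset_union
        H.isOpen_sheetRegion_diff hK.isClosed.isOpen_compl
        (disjoint_left.2 fun y hy hy' => hy' hy.1) ?_
        ⟨x, mem_connectedComponentIn hxS, hx, hxS⟩
      intro y hy
      by_cases hyN : y ∈ sheetRegion f η univ
      · exact Or.inl ⟨hyN, connectedComponentIn_subset _ _ hy⟩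
      · exact Or.inr hyN
    exact hsub.trans sdiff_subset

end IsTwoSheetedLift

end BoundedRegion

/-! ### Coordinates and smoothness of vector-valued maps -/

section SmoothTools

/-- The last two coordinates of a point of `ℝ³`. -/
noncomputable def tailProj (y : Space) : Plane := !₂[y 1, y 2]

lemma contDiff_stdProj : ContDiff ℝ ∞ stdProj := by
  rw [contDiff_euclidean]
  intro i
  fin_cases i <;> simp [stdProj] <;> fun_prop

lemma contDiff_tailProj : ContDiff ℝ ∞ tailProj := by
  rw [contDiff_euclidean]
  intro i
  fin_cases i <;> simp [tailProj] <;> fun_prop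

variable {E : Type*} [NormedAddCommGroup E] [NormedSpace ℝ E] {s : Set E}

lemma ContDiffOn.vec_two {a b : E → ℝ} (ha : ContDiffOn ℝ ∞ a s) (hb : ContDiffOn ℝ ∞ b s) :
    ContDiffOn ℝ ∞ (fun x => (!₂[a x, b x] : Plane)) s := by
  rw [contDiffOn_euclidean]
  intro i
  fin_cases i
  · exact ha
  · exact hb

lemma ContDiffOn.vec_three {a b c : E → ℝ} (ha : ContDiffOn ℝ ∞ a s) (hb : ContDiffOn ℝ ∞ b s)
    (hc : ContDiffOn ℝ ∞ c s) : ContDiffOn ℝ ∞ (fun x => (!₂[a x, b x, c x] : Space)) s := by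
  rw [contDiffOn_euclidean]
  intro i
  fin_cases i
  · exact ha
  · exact hb
  · exact hc

lemma ContDiffOn.coord {n : ℕ} {g : E → EuclideanSpace ℝ (Fin n)} (hg : ContDiffOn ℝ ∞ g s)
    (i : Fin n) : ContDiffOn ℝ ∞ (fun x => g x i) s :=
  contDiffOn_euclidean.1 hg i

lemma plane_ext {x y : Plane} (h0 : x 0 = y 0) (h1 : x 1 = y 1) : x = y := by
  ext i; fin_cases i
  · exact h0
  · exact h1

lemma plane_vec_inj {a b c d : ℝ} (h : (!₂[a, b] : Plane) = !₂[c, d]) : a = c ∧ b = d :=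
  ⟨by simpa using congrArg (fun z : Plane => z 0) h,
    by simpa using congrArg (fun z : Plane => z 1) h⟩

lemma space_ext_coord {x y : Space} (h0 : x 0 = y 0) (h1 : x 1 = y 1) (h2 : x 2 = y 2) :
    x = y := by
  ext i; fin_cases i
  · exact h0
  · exact h1
  · exact h2

end SmoothTools

/-! ### Straightening a graph -/

section GraphChart

/-- The straightening of the graph of `b` over `Ω`, on the side `σ` of the graph of `a`. -/
noncomputable def graphChart (Ω : Set Plane) (hΩ : IsOpen Ω) (a b : Plane → ℝ)
    (ha : ContinuousOn a Ω) (hb : ContinuousOn b Ω) (σ : ℝ) (hσ : σ * σ = 1) :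
    OpenPartialHomeomorph Space Space where
  toFun x := !₂[σ * (b (stdProj x) - x 2), x 0, x 1]
  -- Since `σ * σ = 1`, solving `y 0 = σ * (b - x 2)` for `x 2` gives `b - σ * y 0`.
  invFun y := atHeight (tailProj y) (b (tailProj y) - σ * y 0)
  source := stdProj ⁻¹' Ω ∩ (fun x => σ * (x 2 - a (stdProj x))) ⁻¹' Ioi 0
  target := tailProj ⁻¹' Ω ∩ (fun y => σ * (b (tailProj y) - a (tailProj y)) - y 0) ⁻¹' Ioi 0
  map_source' x hx := by
    have ht : tailProj !₂[σ * (b (stdProj x) - x 2), x 0, x 1] = stdProj x := rfl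
    refine ⟨by rw [mem_preimage, ht]; exact hx.1, ?_⟩
    have h2 : 0 < σ * (x 2 - a (stdProj x)) := hx.2
    simp only [mem_preimage, mem_Ioi, ht]
    simp
    linarith
  map_target' y hy := by
    refine ⟨by rw [mem_preimage, stdProj_atHeight]; exact hy.1, ?_⟩
    have h2 : 0 < σ * (b (tailProj y) - a (tailProj y)) - y 0 := hy.2
    simp only [mem_preimage, mem_Ioi, stdProj_atHeight, atHeight_two]
    linear_combination h2 + (y 0) * hσ
  left_inv' x hx := by
    have ht : tailProj !₂[σ * (b (stdProj x) - x 2), x 0, x 1] = stdProj x := rfl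
    refine space_ext (by rw [stdProj_atHeight, ht]) ?_
    rw [atHeight_two, ht]
    simp
    linear_combination (x 2 - b (stdProj x)) * hσ
  right_inv' y hy := by
    refine space_ext_coord ?_ rfl rfl
    simp only [stdProj_atHeight, atHeight_two]
    simp
    linear_combination (y 0) * hσ
  open_source := by
    refine ContinuousOn.isOpen_inter_preimage ?_ (hΩ.preimage stdProj_continuous) isOpen_Ioi
    have := ha.comp stdProj_continuous.continuousOn fun x (hx : x ∈ stdProj ⁻¹' Ω) => hx
    exact continuousOn_const.mul
      ((by fun_prop : Continuous fun x : Space => x 2).continuousOn.sub this)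
  open_target := by
    have htc := contDiff_tailProj.continuous
    refine ContinuousOn.isOpen_inter_preimage ?_ (hΩ.preimage htc) isOpen_Ioi
    have h1 := ha.comp htc.continuousOn fun x (hx : x ∈ tailProj ⁻¹' Ω) => hx
    have h2 := hb.comp htc.continuousOn fun x (hx : x ∈ tailProj ⁻¹' Ω) => hx
    exact (continuousOn_const.mul (h2.sub h1)).sub
      (by fun_prop : Continuous fun x : Space => x 0).continuousOn
  continuousOn_toFun := by
    have h2 := hb.comp stdProj_continuous.continuousOn fun x (hx : x ∈ stdProj ⁻¹' Ω) => hx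
    refine ContinuousOn.mono ?_ inter_subset_left
    refine (PiLp.continuous_toLp 2 _).comp_continuousOn (continuousOn_pi.2 fun i => ?_)
    fin_cases i
    · exact continuousOn_const.mul
        (h2.sub (by fun_prop : Continuous fun x : Space => x 2).continuousOn)
    · exact (by fun_prop : Continuous fun x : Space => x 0).continuousOn
    · exact (by fun_prop : Continuous fun x : Space => x 1).continuousOn
  continuousOn_invFun := by
    have htc := contDiff_tailProj.continuous
    have h2 := hb.comp htc.continuousOn fun x (hx : x ∈ tailProj ⁻¹' Ω) => hx
    refine ContinuousOn.mono ?_ inter_subset_left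
    exact continuous_atHeight.comp_continuousOn (htc.continuousOn.prodMk
      (h2.sub (by fun_prop : Continuous fun x : Space => σ * x 0).continuousOn))

lemma contDiffOn_graphChart {Ω : Set Plane} {hΩ : IsOpen Ω} {a b : Plane → ℝ}
    {ha : ContinuousOn a Ω} {hb : ContinuousOn b Ω} {σ : ℝ} {hσ : σ * σ = 1}
    (hb' : ContDiffOn ℝ ∞ b Ω) :
    ContDiffOn ℝ ∞ (graphChart Ω hΩ a b ha hb σ hσ) (graphChart Ω hΩ a b ha hb σ hσ).source := by
  have h2 := hb'.comp contDiff_stdProj.contDiffOn fun x (hx : x ∈ stdProj ⁻¹' Ω) => hx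
  refine ContDiffOn.mono (s := stdProj ⁻¹' Ω) ?_ inter_subset_left
  exact ContDiffOn.vec_three (contDiffOn_const.mul
    (h2.sub (by fun_prop : ContDiff ℝ ∞ fun x : Space => x 2).contDiffOn))
    (by fun_prop : ContDiff ℝ ∞ fun x : Space => x 0).contDiffOn
    (by fun_prop : ContDiff ℝ ∞ fun x : Space => x 1).contDiffOn

lemma contDiffOn_graphChart_symm {Ω : Set Plane} {hΩ : IsOpen Ω} {a b : Plane → ℝ}
    {ha : ContinuousOn a Ω} {hb : ContinuousOn b Ω} {σ : ℝ} {hσ : σ * σ = 1}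
    (hb' : ContDiffOn ℝ ∞ b Ω) :
    ContDiffOn ℝ ∞ (graphChart Ω hΩ a b ha hb σ hσ).symm
      (graphChart Ω hΩ a b ha hb σ hσ).target := by
  have h2 := hb'.comp contDiff_tailProj.contDiffOn fun x (hx : x ∈ tailProj ⁻¹' Ω) => hx
  refine ContDiffOn.mono (s := tailProj ⁻¹' Ω) ?_ inter_subset_left
  exact ContDiffOn.vec_three
    (by fun_prop : ContDiff ℝ ∞ fun x : Space => x 1).contDiffOn
    (by fun_prop : ContDiff ℝ ∞ fun x : Space => x 2).contDiffOn
    (h2.sub (by fun_prop : ContDiff ℝ ∞ fun x : Space => σ * x 0).contDiffOn)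

end GraphChart

/-! ### Straightening a folded surface -/

section FoldStraightening

/-- In the coordinates `(s, t) = ψ (x₀, x₁)` and `z = x₂` the surface `t = v²`, `z = h (s, v)`
is straightened by `(t - v², s, v)`, where `(s, v) = G⁻¹ (s, z)` and `G (s, v) = (s, h (s, v))`. -/
noncomputable def foldStraightening (ψ G : OpenPartialHomeomorph Plane Plane) (h : Plane → ℝ)
    (hG : ∀ y ∈ G.source, G y = !₂[y 0, h y]) (hh : ContinuousOn h G.source) :
    OpenPartialHomeomorph Space Space where
  toFun x := !₂[ψ (stdProj x) 1 - G.symm !₂[ψ (stdProj x) 0, x 2] 1 ^ 2, ψ (stdProj x) 0,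
    G.symm !₂[ψ (stdProj x) 0, x 2] 1]
  invFun y := atHeight (ψ.symm !₂[y 1, y 0 + y 2 ^ 2]) (h (tailProj y))
  source := stdProj ⁻¹' ψ.source ∩ (fun x => (!₂[ψ (stdProj x) 0, x 2] : Plane)) ⁻¹' G.target
  target := (fun y : Space => (!₂[y 1, y 0 + y 2 ^ 2] : Plane)) ⁻¹' ψ.target ∩
    tailProj ⁻¹' G.source
  map_source' x hx := by
    set w := G.symm !₂[ψ (stdProj x) 0, x 2] with hw
    have hws : w ∈ G.source := G.map_target hx.2
    have hGw : G w = !₂[ψ (stdProj x) 0, x 2] := G.right_inv hx.2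
    rw [hG w hws] at hGw
    have hw0 : w 0 = ψ (stdProj x) 0 := (plane_vec_inj hGw).1
    constructor
    · have : (!₂[ψ (stdProj x) 0, ψ (stdProj x) 1 - w 1 ^ 2 + w 1 ^ 2] : Plane) =
          ψ (stdProj x) := plane_ext rfl (by simp)
      change (!₂[ψ (stdProj x) 0, ψ (stdProj x) 1 - w 1 ^ 2 + w 1 ^ 2] : Plane) ∈ ψ.target
      rw [this]
      exact ψ.map_source hx.1
    · change (!₂[ψ (stdProj x) 0, w 1] : Plane) ∈ G.source
      rwa [show (!₂[ψ (stdProj x) 0, w 1] : Plane) = w from plane_ext hw0.symm rfl]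
  map_target' y hy := by
    have h1 : ψ (ψ.symm !₂[y 1, y 0 + y 2 ^ 2]) = !₂[y 1, y 0 + y 2 ^ 2] := ψ.right_inv hy.1
    refine ⟨by rw [mem_preimage, stdProj_atHeight]; exact ψ.map_target hy.1, ?_⟩
    simp only [mem_preimage, stdProj_atHeight, atHeight_two, h1]
    change (!₂[tailProj y 0, h (tailProj y)] : Plane) ∈ G.target
    rw [← hG _ hy.2]
    exact G.map_source hy.2
  left_inv' x hx := by
    set w := G.symm !₂[ψ (stdProj x) 0, x 2] with hw
    have hws : w ∈ G.source := G.map_target hx.2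
    have hGw : G w = !₂[ψ (stdProj x) 0, x 2] := G.right_inv hx.2
    rw [hG w hws] at hGw
    have hw0 : w 0 = ψ (stdProj x) 0 := (plane_vec_inj hGw).1
    have hw1 : h w = x 2 := (plane_vec_inj hGw).2
    refine space_ext ?_ ?_
    · rw [stdProj_atHeight]
      have : (!₂[ψ (stdProj x) 0, ψ (stdProj x) 1 - w 1 ^ 2 + w 1 ^ 2] : Plane) =
          ψ (stdProj x) := plane_ext rfl (by simp)
      change ψ.symm !₂[ψ (stdProj x) 0, ψ (stdProj x) 1 - w 1 ^ 2 + w 1 ^ 2] = _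
      rw [this, ψ.left_inv hx.1]
    · change h !₂[ψ (stdProj x) 0, w 1] = x 2
      rw [show (!₂[ψ (stdProj x) 0, w 1] : Plane) = w from plane_ext hw0.symm rfl, hw1]
  right_inv' y hy := by
    have h1 : ψ (ψ.symm !₂[y 1, y 0 + y 2 ^ 2]) = !₂[y 1, y 0 + y 2 ^ 2] := ψ.right_inv hy.1
    have h2 : G.symm !₂[tailProj y 0, h (tailProj y)] = tailProj y := by
      rw [← hG _ hy.2, G.left_inv hy.2]
    have h3 : G.symm !₂[y 1, h (tailProj y)] = tailProj y := h2
    simp only [stdProj_atHeight, atHeight_two, h1]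
    refine space_ext_coord ?_ rfl ?_
    · change y 0 + y 2 ^ 2 - G.symm !₂[y 1, h (tailProj y)] 1 ^ 2 = y 0
      rw [h3]
      simp [tailProj]
    · change G.symm !₂[y 1, h (tailProj y)] 1 = y 2
      rw [h3]
      simp [tailProj]
  open_source := by
    refine ContinuousOn.isOpen_inter_preimage ?_ (ψ.open_source.preimage stdProj_continuous)
      G.open_target
    have := ψ.continuousOn.comp stdProj_continuous.continuousOn
      fun x (hx : x ∈ stdProj ⁻¹' ψ.source) => hx
    refine (PiLp.continuous_toLp 2 _).comp_continuousOn (continuousOn_pi.2 fun i => ?_)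
    fin_cases i
    · exact (by fun_prop : Continuous fun x : Plane => x 0).comp_continuousOn this
    · exact (by fun_prop : Continuous fun x : Space => x 2).continuousOn
  open_target := by
    refine IsOpen.inter (ψ.open_target.preimage ?_)
      (G.open_source.preimage contDiff_tailProj.continuous)
    refine (PiLp.continuous_toLp 2 _).comp (continuous_pi fun i => ?_)
    fin_cases i <;> simp <;> fun_prop
  continuousOn_toFun := by
    have h1 := ψ.continuousOn.comp stdProj_continuous.continuousOn
      fun x (hx : x ∈ stdProj ⁻¹' ψ.source ∩
        (fun x => (!₂[ψ (stdProj x) 0, x 2] : Plane)) ⁻¹' G.target) => hx.1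
    have h10 := (by fun_prop : Continuous fun x : Plane => x 0).comp_continuousOn h1
    have h11 := (by fun_prop : Continuous fun x : Plane => x 1).comp_continuousOn h1
    have h2 : ContinuousOn (fun x => (!₂[ψ (stdProj x) 0, x 2] : Plane))
        (stdProj ⁻¹' ψ.source ∩
          (fun x => (!₂[ψ (stdProj x) 0, x 2] : Plane)) ⁻¹' G.target) := by
      refine (PiLp.continuous_toLp 2 _).comp_continuousOn (continuousOn_pi.2 fun i => ?_)
      fin_cases i
      · exact h10
      · exact (by fun_prop : Continuous fun x : Space => x 2).continuousOn
    have h3 := (by fun_prop : Continuous fun x : Plane => x 1).comp_continuousOn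
      (G.symm.continuousOn.comp h2 fun x hx => hx.2)
    refine (PiLp.continuous_toLp 2 _).comp_continuousOn (continuousOn_pi.2 fun i => ?_)
    fin_cases i
    · exact h11.sub (h3.pow 2)
    · exact h10
    · exact h3
  continuousOn_invFun := by
    refine continuous_atHeight.comp_continuousOn (ContinuousOn.prodMk ?_ ?_)
    · refine ψ.symm.continuousOn.comp (Continuous.continuousOn ?_) fun y hy => hy.1
      refine (PiLp.continuous_toLp 2 _).comp (continuous_pi fun i => ?_)
      fin_cases i <;> simp <;> fun_prop
    · exact hh.comp contDiff_tailProj.continuous.continuousOn fun y hy => hy.2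

variable {ψ G : OpenPartialHomeomorph Plane Plane} {h : Plane → ℝ}
  {hG : ∀ y ∈ G.source, G y = !₂[y 0, h y]} {hh : ContinuousOn h G.source}

lemma contDiffOn_foldStraightening (hψ : ContDiffOn ℝ ∞ ψ ψ.source)
    (hG' : ContDiffOn ℝ ∞ G.symm G.target) :
    ContDiffOn ℝ ∞ (foldStraightening ψ G h hG hh) (foldStraightening ψ G h hG hh).source := by
  have h1 := hψ.comp contDiff_stdProj.contDiffOn
    fun x (hx : x ∈ (foldStraightening ψ G h hG hh).source) => hx.1
  have h2 : ContDiffOn ℝ ∞ (fun x => (!₂[ψ (stdProj x) 0, x 2] : Plane))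
      (foldStraightening ψ G h hG hh).source :=
    ContDiffOn.vec_two (h1.coord 0) (by fun_prop : ContDiff ℝ ∞ fun x : Space => x 2).contDiffOn
  have h3 := (hG'.comp h2 fun x hx => hx.2).coord 1
  exact ContDiffOn.vec_three ((h1.coord 1).sub (h3.pow 2)) (h1.coord 0) h3

lemma contDiffOn_foldStraightening_symm (hψ : ContDiffOn ℝ ∞ ψ.symm ψ.target)
    (hh' : ContDiffOn ℝ ∞ h G.source) :
    ContDiffOn ℝ ∞ (foldStraightening ψ G h hG hh).symm
      (foldStraightening ψ G h hG hh).target := by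
  have h1 : ContDiffOn ℝ ∞ (fun y : Space => (!₂[y 1, y 0 + y 2 ^ 2] : Plane))
      (foldStraightening ψ G h hG hh).target :=
    ContDiffOn.vec_two (by fun_prop : ContDiff ℝ ∞ fun x : Space => x 1).contDiffOn
      (by fun_prop : ContDiff ℝ ∞ fun x : Space => x 0 + x 2 ^ 2).contDiffOn
  have h2 := hψ.comp h1 fun x hx => hx.1
  exact ContDiffOn.vec_three (h2.coord 0) (h2.coord 1)
    (hh'.comp contDiff_tailProj.contDiffOn fun x hx => hx.2)

end FoldStraightening

/-! ### Charts at interior points and at sheet points -/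

section AdaptedCharts

variable {M : Type*} [TopologicalSpace M] [ChartedSpace Plane M] {f : M → Plane} {η : M → Space}

/-- `Φ` straightens the surface `η(M)` near `η p`, and `Φ ∘ η` is given by a chart of `M`. -/
structure IsAdaptedChart (f : M → Plane) (η : M → Space) (p : M)
    (Φ : OpenPartialHomeomorph Space Space) : Prop where
  isBoundaryChart : IsBoundaryChart (sheetRegion f η univ) (range η) Φ
  mem_source : η p ∈ Φ.source
  exists_chart : ∃ φ ∈ IsManifold.maximalAtlas (𝓡 2) ∞ M, p ∈ φ.source ∧
    ∀ q ∈ φ.source, η q ∈ Φ.source ∧ Φ (η q) = !₂[0, φ q 0, φ q 1]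

lemma IsBoundaryChart.restr {N S : Set Space} {Φ : OpenPartialHomeomorph Space Space}
    {U : Set Space} (hU : IsOpen U) (h1 : ContDiffOn ℝ ∞ Φ Φ.source)
    (h2 : ContDiffOn ℝ ∞ Φ.symm Φ.target)
    (hN : ∀ x ∈ Φ.source, x ∈ U → (x ∈ N ↔ 0 ≤ Φ x 0))
    (hS : ∀ x ∈ Φ.source, x ∈ U → (x ∈ S ↔ Φ x 0 = 0)) :
    IsBoundaryChart N S (Φ.restr U) := by
  have hs : (Φ.restr U).source = Φ.source ∩ U := Φ.restr_source' U hU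
  refine ⟨?_, ?_, ?_, ?_⟩
  · rw [hs]; exact h1.mono inter_subset_left
  · exact h2.mono (by rw [Φ.restr_target]; exact inter_subset_left)
  · intro x hx; rw [hs] at hx; exact hN x hx.1 hx.2
  · intro x hx; rw [hs] at hx; exact hS x hx.1 hx.2

namespace IsTwoSheetedLift

lemma exists_isBoundaryChart_of_notMem_range (H : IsTwoSheetedLift f η) [T2Space M] {x : Space}
    (hx : x ∈ sheetRegion f η univ) (hxS : x ∉ range η) :
    ∃ Φ, IsBoundaryChart (sheetRegion f η univ) (range η) Φ ∧ x ∈ Φ.source := by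
  -- Translation sending the first coordinate of `x` to `1`: nearby points then have positive normal
  -- coordinate, as interior points must.
  let v : Space := !₂[1 - x 0, 0, 0]
  let Φ := (Homeomorph.addRight v).toOpenPartialHomeomorph
  have hΦ : ∀ y, Φ y = y + v := fun y => rfl
  have hΦs : ∀ y, Φ.symm y = y + -v := fun y => rfl
  have h0 : Continuous fun y : Space => y 0 := by fun_prop
  let U : Set Space := (sheetRegion f η univ \ range η) ∩ {y | x 0 - 1 < y 0}
  have hU : IsOpen U := H.isOpen_sheetRegion_diff.inter (isOpen_lt continuous_const h0)
  have hpos : ∀ y ∈ U, 0 < Φ y 0 := by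
    rintro y ⟨-, hy⟩
    have hy' : x 0 - 1 < y 0 := hy
    rw [hΦ]
    simp [v]
    linarith
  refine ⟨Φ.restr U, IsBoundaryChart.restr hU ?_ ?_ ?_ ?_, ?_⟩
  · have : ContDiff ℝ ∞ fun y : Space => y + v := by fun_prop
    exact this.contDiffOn
  · have : ContDiff ℝ ∞ fun y : Space => y + -v := by fun_prop
    exact this.contDiffOn
  · exact fun y _ hy => ⟨fun _ => (hpos y hy).le, fun _ => hy.1.1⟩
  · exact fun y _ hy => ⟨fun h => absurd h hy.1.2, fun h => absurd h (hpos y hy).ne'⟩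
  · rw [Φ.restr_source' U hU]
    exact ⟨mem_univ _, ⟨hx, hxS⟩, show x 0 - 1 < x 0 by linarith⟩

/-- The fibre has exactly one other point `q`, again a sheet point. Locally `N` lies between the
graphs `b` through `η p` and `a` through `η q`; on the `p` side of `a` it is cut out by `b` alone.
-/
lemma exists_isAdaptedChart_of_isSheetPoint (H : IsTwoSheetedLift f η)
    [T2Space M] [CompactSpace M] [IsManifold (𝓡 2) ∞ M]
    (hη : ContMDiff (𝓡 2) (𝓡 3) ∞ η) {p : M} (hp : IsSheetPoint f p) :
    ∃ Φ, IsAdaptedChart f η p Φ := by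
  obtain ⟨q, hqp, hfq⟩ := H.exists_ne_of_isSheetPoint hp
  have hq := H.isSheetPoint_of_fiber hfq.symm hp
  obtain ⟨φ, hφ, hpφ, hφf⟩ := hp
  obtain ⟨χ, hχ, hqχ, hχf⟩ := hq
  have hne : η p 2 ≠ η q 2 := fun h => hqp (H.eq_of_height_eq hfq h.symm)
  -- The sign is `1` when `p` is on the upper sheet and `-1` when it is on the lower one.
  obtain ⟨σ, hσ, hσpq⟩ : ∃ σ : ℝ, (σ = 1 ∨ σ = -1) ∧ 0 < σ * (η p 2 - η q 2) := by
    rcases lt_or_gt_of_ne hne with h | h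
    · exact ⟨-1, Or.inr rfl, by linarith⟩
    · exact ⟨1, Or.inl rfl, by linarith⟩
  have hσσ : σ * σ = 1 := by rcases hσ with rfl | rfl <;> norm_num
  let b : Plane → ℝ := fun r => η (φ.symm r) 2
  let a : Plane → ℝ := fun r => η (χ.symm r) 2
  have hb : ContDiffOn ℝ ∞ b φ.target := (contDiffOn_comp_symm_of_mem_maximalAtlas hη hφ).coord 2
  have ha : ContDiffOn ℝ ∞ a χ.target := (contDiffOn_comp_symm_of_mem_maximalAtlas hη hχ).coord 2
  -- Over `Ω` the two local inverses of `f` are defined and take distinct values, so they exhaust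
  -- the fibre.
  let Ω : Set Plane := (φ.target ∩ χ.target) ∩ (fun r => σ * (b r - a r)) ⁻¹' Ioi 0
  have hΩ : IsOpen Ω := by
    refine ContinuousOn.isOpen_inter_preimage ?_ (φ.open_target.inter χ.open_target) isOpen_Ioi
    exact continuousOn_const.mul ((hb.continuousOn.mono inter_subset_left).sub
      (ha.continuousOn.mono inter_subset_right))
  have hb' : ContDiffOn ℝ ∞ b Ω := hb.mono fun r hr => hr.1.1
  have ha' : ContDiffOn ℝ ∞ a Ω := ha.mono fun r hr => hr.1.2
  have hfφ : ∀ r ∈ φ.target, f (φ.symm r) = r := fun r hr => by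
    rw [← hφf _ (φ.map_target hr), φ.right_inv hr]
  have hfχ : ∀ r ∈ χ.target, f (χ.symm r) = r := fun r hr => by
    rw [← hχf _ (χ.map_target hr), χ.right_inv hr]
  have hfib : ∀ r ∈ Ω, ∀ m, f m = r → m = φ.symm r ∨ m = χ.symm r := by
    intro r hr m hm
    rcases H.card m (φ.symm r) (χ.symm r) (by rw [hm, hfφ r hr.1.1]) (by rw [hm, hfχ r hr.1.2])
      with h | h | h
    · exact Or.inl h
    · exact Or.inr h
    · have h2 : 0 < σ * (b r - a r) := hr.2
      simp only [b, a, h, sub_self, mul_zero, lt_irrefl] at h2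
  let Φ := graphChart Ω hΩ a b ha'.continuousOn hb'.continuousOn σ hσσ
  have hΦ0 : ∀ x, Φ x 0 = σ * (b (stdProj x) - x 2) := fun x => rfl
  have hsrc : ∀ x, x ∈ Φ.source ↔ stdProj x ∈ Ω ∧ 0 < σ * (x 2 - a (stdProj x)) :=
    fun x => Iff.rfl
  have hbm : ∀ m ∈ φ.source, b (f m) = η m 2 := fun m hm => by
    simp only [b]; rw [← hφf m hm, φ.left_inv hm]
  have ham : ∀ m ∈ χ.source, a (f m) = η m 2 := fun m hm => by
    simp only [a]; rw [← hχf m hm, χ.left_inv hm]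
  have hpΩ : f p ∈ Ω := by
    refine ⟨⟨?_, ?_⟩, ?_⟩
    · rw [← hφf p hpφ]; exact φ.map_source hpφ
    · rw [← hfq, ← hχf q hqχ]; exact χ.map_source hqχ
    · rw [mem_preimage, hbm p hpφ, ← hfq, ham q hqχ]; exact hσpq
  refine ⟨Φ, ⟨contDiffOn_graphChart hb', contDiffOn_graphChart_symm hb', ?_, ?_⟩, ?_, ?_⟩
  · intro x hx
    obtain ⟨hxΩ, hxa⟩ := (hsrc x).1 hx
    rw [hΦ0]
    constructor
    · rintro ⟨m, -, n, -, ⟨hmn, -⟩, hseg⟩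
      obtain ⟨hxm, hx2⟩ := (H.mem_segment_iff hmn).1 hseg
      have hm : η m 2 = b (stdProj x) ∨ η m 2 = a (stdProj x) :=
        (hfib _ hxΩ m hxm.symm).imp (fun h => by rw [h]) (fun h => by rw [h])
      have hn : η n 2 = b (stdProj x) ∨ η n 2 = a (stdProj x) :=
        (hfib _ hxΩ n (hmn ▸ hxm.symm)).imp (fun h => by rw [h]) (fun h => by rw [h])
      have hΩ2 : 0 < σ * (b (stdProj x) - a (stdProj x)) := hxΩ.2
      rw [mem_uIcc] at hx2
      rcases hσ with rfl | rfl <;> rcases hm with hm | hm <;> rcases hn with hn | hn <;>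
        rw [hm, hn] at hx2 <;> rcases hx2 with hx2 | hx2 <;> linarith [hx2.1, hx2.2]
    · intro h0
      refine H.mem_sheetRegion_of_le (mem_univ (φ.symm (stdProj x)))
        (mem_univ (χ.symm (stdProj x))) ⟨φ, hφ, φ.map_target hxΩ.1.1, hφf⟩ (hfφ _ hxΩ.1.1)
        (hfχ _ hxΩ.1.2) ?_
      change x 2 ∈ uIcc (b (stdProj x)) (a (stdProj x))
      rw [mem_uIcc]
      rcases hσ with rfl | rfl
      · right; constructor <;> linarith
      · left; constructor <;> linarith
  · intro x hx
    obtain ⟨hxΩ, hxa⟩ := (hsrc x).1 hx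
    rw [hΦ0]
    constructor
    · rintro ⟨m, rfl⟩
      rw [H.lift] at hxΩ hxa ⊢
      rcases hfib _ hxΩ m rfl with h | h
      · have : η m 2 = b (f m) := by simp only [b]; rw [← h]
        rw [this]; simp
      · have : η m 2 = a (f m) := by simp only [a]; rw [← h]
        rw [this] at hxa; simp at hxa
    · intro h0
      have hσ0 : σ ≠ 0 := by rintro rfl; simp at hσσ
      have h2 : b (stdProj x) - x 2 = 0 := (mul_eq_zero.1 h0).resolve_left hσ0
      exact ⟨φ.symm (stdProj x), space_ext (by rw [H.lift, hfφ _ hxΩ.1.1]) (by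
        change b (stdProj x) = x 2; linarith)⟩
  · rw [hsrc, H.lift]
    refine ⟨hpΩ, ?_⟩
    rw [← hfq, ham q hqχ]
    exact hσpq
  · have hV : IsOpen (f ⁻¹' Ω) := hΩ.preimage H.continuous_map
    refine ⟨φ.restr (f ⁻¹' Ω), restr_mem_maximalAtlas _ hφ hV, ?_, ?_⟩
    · rw [φ.restr_source' _ hV]
      exact ⟨hpφ, hpΩ⟩
    · intro m hm
      rw [φ.restr_source' _ hV] at hm
      have hm2 : f m ∈ Ω := hm.2
      have hm3 : 0 < σ * (b (f m) - a (f m)) := hm2.2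
      constructor
      · rw [hsrc, H.lift]
        refine ⟨hm2, ?_⟩
        rwa [← hbm m hm.1]
      · have hfm : φ m = stdProj (η m) := by rw [H.lift, hφf m hm.1]
        refine space_ext_coord ?_ ?_ ?_
        · rw [hΦ0, H.lift, hbm m hm.1]; simp
        · change η m 0 = φ m 0
          rw [hfm]; rfl
        · change η m 1 = φ m 1
          rw [hfm]; rfl

end IsTwoSheetedLift

end AdaptedCharts

/-! ### Preparations in a fold chart: monotone slices and boxes -/

section FoldAdaptedCharts

/-- In a fold chart, `f` is injective near the points off the fold line. -/
lemma exists_injOn_of_fold_chart {M : Type*} [TopologicalSpace M] {f : M → Plane}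
    {φ : OpenPartialHomeomorph M Plane}
    {ψ : OpenPartialHomeomorph Plane Plane}
    (h : ∀ q ∈ φ.source, f q ∈ ψ.source ∧ ψ (f q) = !₂[φ q 0, (φ q 1) ^ 2]) {a : M}
    (ha : a ∈ φ.source) (ha1 : φ a 1 ≠ 0) : ∃ U ∈ 𝓝 a, InjOn f U := by
  have hc : ContinuousOn (fun m => φ m 1 * φ a 1) φ.source :=
    ((by fun_prop : Continuous fun x : Plane => x 1).comp_continuousOn φ.continuousOn).mul
      continuousOn_const
  refine ⟨φ.source ∩ (fun m => φ m 1 * φ a 1) ⁻¹' Ioi 0,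
    (hc.isOpen_inter_preimage φ.open_source isOpen_Ioi).mem_nhds ⟨ha, mul_self_pos.2 ha1⟩, ?_⟩
  rintro m ⟨hm, hm'⟩ n ⟨hn, hn'⟩ hmn
  have hm'' : 0 < φ m 1 * φ a 1 := hm'
  have hn'' : 0 < φ n 1 * φ a 1 := hn'
  have heq := (h m hm).2
  rw [hmn, (h n hn).2] at heq
  obtain ⟨h0, h1⟩ := plane_vec_inj heq
  refine φ.injOn hm hn (plane_ext h0.symm ?_)
  rcases sq_eq_sq_iff_eq_or_eq_neg.1 h1 with h2 | h2
  · exact h2.symm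
  · rw [h2] at hn''
    linarith

/-- A continuous injective function on an interval is strictly monotone. Applied to the height on a
slice of a fold chart, this turns the vertical condition defining `N` into `w² ≤ u²`. -/
lemma mem_uIcc_neg_iff_of_injOn {g : ℝ → ℝ} {ε : ℝ} (hc : ContinuousOn g (Ioo (-ε) ε))
    (hi : InjOn g (Ioo (-ε) ε)) {u w : ℝ} (hu : u ∈ Ioo (-ε) ε) (hw : w ∈ Ioo (-ε) ε) :
    g w ∈ uIcc (g u) (g (-u)) ↔ w ^ 2 ≤ u ^ 2 := by
  have hu' : -u ∈ Ioo (-ε) ε := ⟨by linarith [hu.2], by linarith [hu.1]⟩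
  have hε : -ε < ε := hu.1.trans hu.2
  have hkey : (w ^ 2 ≤ u ^ 2) ↔ (u ≤ w ∧ w ≤ -u) ∨ (-u ≤ w ∧ w ≤ u) := by
    rw [sq_le_sq, abs_le]
    rcases le_total 0 u with h | h
    · rw [abs_of_nonneg h]
      constructor
      · exact fun h => Or.inr h
      · rintro (⟨h1, h2⟩ | h)
        · constructor <;> linarith
        · exact h
    · rw [abs_of_nonpos h, neg_neg]
      constructor
      · exact fun h => Or.inl h
      · rintro (h | ⟨h1, h2⟩)
        · exact h
        · constructor <;> linarith
  rw [mem_uIcc, hkey]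
  rcases hc.strictMonoOn_of_injOn_Ioo hε hi with hm | hm
  · rw [hm.le_iff_le hu hw, hm.le_iff_le hw hu', hm.le_iff_le hu' hw, hm.le_iff_le hw hu]
  · rw [hm.le_iff_ge hu hw, hm.le_iff_ge hw hu', hm.le_iff_ge hu' hw, hm.le_iff_ge hw hu]
    tauto

/-- The open box of side `2ε` around the origin of the plane. -/
def planeBox (ε : ℝ) : Set Plane := {y | y 0 ∈ Ioo (-ε) ε ∧ y 1 ∈ Ioo (-ε) ε}

lemma isOpen_planeBox (ε : ℝ) : IsOpen (planeBox ε) :=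
  (isOpen_Ioo.preimage (by fun_prop : Continuous fun y : Plane => y 0)).inter
    (isOpen_Ioo.preimage (by fun_prop : Continuous fun y : Plane => y 1))

lemma exists_planeBox_subset {U : Set Plane} (hU : U ∈ 𝓝 (0 : Plane)) :
    ∃ ε > 0, planeBox ε ⊆ U := by
  obtain ⟨δ, hδ, hball⟩ := Metric.mem_nhds_iff.1 hU
  refine ⟨δ / 2, by positivity, fun y hy => hball ?_⟩
  rw [mem_ball_zero_iff, EuclideanSpace.norm_eq, Real.sqrt_lt' hδ, Fin.sum_univ_two]
  obtain ⟨⟨h1, h2⟩, h3, h4⟩ := hy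
  simp only [Real.norm_eq_abs, sq_abs]
  nlinarith

lemma flipSnd_mem_planeBox {ε : ℝ} {y : Plane} (hy : y ∈ planeBox ε) :
    flipSnd y ∈ planeBox ε := by
  obtain ⟨h1, h2, h3⟩ := hy
  refine ⟨h1, ?_⟩
  simp only [flipSnd]
  constructor <;> simp <;> linarith

end FoldAdaptedCharts

/-! ### Immersions have injective differential in every chart -/

section Immersion

variable {M : Type*} [TopologicalSpace M] [ChartedSpace Plane M] {η : M → Space}

lemma injective_fderiv_of_isImmersionAt [IsManifold (𝓡 2) ∞ M] {p : M}
    (hη : Manifold.IsImmersionAt (𝓡 2) (𝓡 3) ∞ η p) {φ : OpenPartialHomeomorph M Plane}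
    (hφ : φ ∈ IsManifold.maximalAtlas (𝓡 2) ∞ M) (hp : p ∈ φ.source) :
    Function.Injective (fderiv ℝ (η ∘ φ.symm) (φ p)) := by
  obtain ⟨F, _, _, h⟩ := hη
  obtain ⟨e, Ψ, hpe, hpΨ, he, hΨ, hsrc, E, hE⟩ := h
  -- Projection to the first factor in the immersion normal form, which recovers the source
  -- coordinates from `Ψ ∘ η`.
  let L : Space →L[ℝ] Plane := (ContinuousLinearMap.fst ℝ Plane F).comp
    (E.symm : Space →L[ℝ] Plane × F)
  have hΨη : ∀ q ∈ e.source, L (Ψ (η q)) = e q := by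
    intro q hq
    have hq' : e q ∈ (e.extend (𝓡 2)).target := by
      rw [e.extend_target]
      exact ⟨by simpa using e.map_source hq, by simp⟩
    have := hE hq'
    simp only [Function.comp, OpenPartialHomeomorph.extend_coe,
      OpenPartialHomeomorph.extend_coe_symm, modelWithCornersSelf_coe,
      modelWithCornersSelf_coe_symm, id, e.left_inv hq] at this
    rw [this]
    simp [L]
  -- a smooth left inverse of `η ∘ φ⁻¹` near `φ p`
  let Λ : Space → Plane := fun x => φ (e.symm (L (Ψ x)))
  have hΛ : DifferentiableAt ℝ Λ (η p) := by
    have h1 : ContMDiffAt (𝓡 3) (𝓡 3) ∞ Ψ (η p) := contMDiffAt_of_mem_maximalAtlas hΨ hpΨ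
    have h2 : ContMDiffAt (𝓡 3) (𝓡 2) ∞ (fun x => L (Ψ x)) (η p) :=
      (L.contDiff.contMDiff (n := ∞)).contMDiffAt.comp (η p) h1
    have h3 : ContMDiffAt (𝓡 3) (𝓡 2) ∞ (fun x => e.symm (L (Ψ x))) (η p) := by
      refine ContMDiffAt.comp (η p) (g := e.symm) ?_ h2
      rw [hΨη p hpe]
      exact contMDiffAt_symm_of_mem_maximalAtlas he (e.map_source hpe)
    have h4 : ContMDiffAt (𝓡 3) (𝓡 2) ∞ Λ (η p) := by
      refine ContMDiffAt.comp (η p) (g := φ) ?_ h3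
      rw [hΨη p hpe, e.left_inv hpe]
      exact contMDiffAt_of_mem_maximalAtlas hφ hp
    exact (contMDiffAt_iff_contDiffAt.1 h4).differentiableAt (by simp)
  have hηφ : DifferentiableAt ℝ (η ∘ φ.symm) (φ p) := by
    have h0 : ContMDiffAt (𝓡 2) (𝓡 3) ∞ η p :=
      Manifold.IsImmersionAt.contMDiffAt ⟨F, _, _, ⟨e, Ψ, hpe, hpΨ, he, hΨ, hsrc, E, hE⟩⟩
    have h1 : ContMDiffAt (𝓡 2) (𝓡 3) ∞ (η ∘ φ.symm) (φ p) := by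
      refine ContMDiffAt.comp (φ p) ?_
        (contMDiffAt_symm_of_mem_maximalAtlas hφ (φ.map_source hp))
      rwa [φ.left_inv hp]
    exact (contMDiffAt_iff_contDiffAt.1 h1).differentiableAt (by simp)
  have hid : Λ ∘ (η ∘ φ.symm) =ᶠ[𝓝 (φ p)] id := by
    have : ∀ᶠ y in 𝓝 (φ p), φ.symm y ∈ e.source :=
      (φ.continuousAt_symm (φ.map_source hp)).eventually
        (by rw [φ.left_inv hp]; exact e.open_source.mem_nhds hpe)
    filter_upwards [this, φ.open_target.mem_nhds (φ.map_source hp)] with y hy hy'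
    simp only [Λ, Function.comp, hΨη _ hy, e.left_inv hy, φ.right_inv hy', id]
  have hval : (η ∘ φ.symm) (φ p) = η p := by simp [φ.left_inv hp]
  have hcomp := fderiv_comp (φ p) (by rw [hval]; exact hΛ) hηφ
  rw [hid.fderiv_eq, fderiv_id] at hcomp
  refine Function.LeftInverse.injective (g := fderiv ℝ Λ ((η ∘ φ.symm) (φ p))) fun v => ?_
  exact (DFunLike.congr_fun hcomp v).symm

end Immersion

/-! ### Charts at fold points -/

section FoldModel

lemma hasDerivAt_euclidean_iff {n : ℕ} {g : ℝ → EuclideanSpace ℝ (Fin n)}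
    {g' : EuclideanSpace ℝ (Fin n)} {t : ℝ} :
    HasDerivAt g g' t ↔ ∀ i, HasDerivAt (fun s => g s i) (g' i) t := by
  simp only [hasDerivAt_iff_hasFDerivAt, ← hasFDerivWithinAt_univ]
  rw [hasFDerivWithinAt_euclidean]
  refine forall_congr' fun i => ?_
  rw [iff_iff_eq]
  congr 1

/-- The map `(u, v) ↦ (u, η(u, v)₂)` in a fold chart is a local diffeomorphism at the origin. -/
lemma injective_fderiv_height_of_fold_chart {M : Type*} [TopologicalSpace M]
    {f : M → Plane} {η : M → Space}
    {φ : OpenPartialHomeomorph M Plane} {ψ : OpenPartialHomeomorph Plane Plane}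
    (hlift : ∀ x, stdProj (η x) = f x) {p : M}
    (hp : p ∈ φ.source) (hp0 : φ p = 0) (hψ : ContDiffOn ℝ ∞ ψ.symm ψ.target)
    (h : ∀ q ∈ φ.source, f q ∈ ψ.source ∧ ψ (f q) = !₂[φ q 0, (φ q 1) ^ 2])
    (hη : ContDiffOn ℝ ∞ (η ∘ φ.symm) φ.target)
    (hinj : Function.Injective (fderiv ℝ (η ∘ φ.symm) 0)) :
    Function.Injective (fderiv ℝ (fun y => (!₂[y 0, η (φ.symm y) 2] : Plane)) 0) := by
  have h0t : (0 : Plane) ∈ φ.target := hp0 ▸ φ.map_source hp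
  have hat : ContDiffAt ℝ ∞ (η ∘ φ.symm) 0 := hη.contDiffAt (φ.open_target.mem_nhds h0t)
  have hd := (hat.differentiableAt (by simp)).hasFDerivAt
  set D := fderiv ℝ (η ∘ φ.symm) 0
  rw [injective_iff_map_eq_zero]
  -- A kernel vector has `v 0 = 0` and the third component of `D v` is zero. The first two
  -- components of `D v` are those of the derivative of `f`, which vanish because `f` depends on the
  -- second coordinate through its square. So `D v = 0`, against the immersion hypothesis.
  intro v hv
  have hH : HasFDerivAt (fun y => (!₂[y 0, η (φ.symm y) 2] : Plane))
      (fderiv ℝ (fun y => (!₂[y 0, η (φ.symm y) 2] : Plane)) 0) 0 := by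
    have : ContDiffOn ℝ ∞ (fun y => (!₂[y 0, η (φ.symm y) 2] : Plane)) φ.target :=
      ContDiffOn.vec_two (by fun_prop : ContDiff ℝ ∞ fun y : Plane => y 0).contDiffOn (hη.coord 2)
    exact ((this.contDiffAt (φ.open_target.mem_nhds h0t)).differentiableAt (by simp)).hasFDerivAt
  -- differentiate along the line spanned by `v`
  have hline : HasDerivAt (fun t : ℝ => t • v) v 0 := by
    simpa using (hasDerivAt_id (0 : ℝ)).smul_const v
  have hHl : HasDerivAt (fun t : ℝ => (!₂[(t • v) 0, η (φ.symm (t • v)) 2] : Plane)) 0 0 := by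
    have := HasFDerivAt.comp_hasDerivAt_of_eq (0 : ℝ) hH hline (by simp)
    rw [hv] at this
    exact this
  have hDl : HasDerivAt (fun t : ℝ => η (φ.symm (t • v))) (D v) 0 :=
    HasFDerivAt.comp_hasDerivAt_of_eq (0 : ℝ) hd hline (by simp)
  rw [hasDerivAt_euclidean_iff] at hHl hDl
  have hv0 : v 0 = 0 := by
    have h1 : HasDerivAt (fun t : ℝ => t * v 0) (v 0) 0 := by
      simpa using (hasDerivAt_id (0 : ℝ)).mul_const (v 0)
    have h2 : HasDerivAt (fun t : ℝ => t * v 0) 0 0 := by simpa using hHl 0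
    exact h1.unique h2
  have hD2 : D v 2 = 0 := by
    have h2 : HasDerivAt (fun t : ℝ => η (φ.symm (t • v)) 2) 0 0 := by simpa using hHl 1
    exact (hDl 2).unique h2
  have hf : HasDerivAt (fun t : ℝ => f (φ.symm (t • v))) 0 0 := by
    have hsq : HasDerivAt (fun t : ℝ => (!₂[t * v 0, (t * v 1) ^ 2] : Plane)) 0 0 := by
      rw [hasDerivAt_euclidean_iff]
      intro i
      fin_cases i
      · simpa [hv0] using hasDerivAt_const (0 : ℝ) (0 : ℝ)
      · have hpow := ((hasDerivAt_id (0 : ℝ)).mul_const (v 1)).pow 2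
        simp only [id, zero_mul, Nat.add_one_sub_one,
          pow_one, mul_zero] at hpow
        exact hpow
    have hψ0 : (0 : Plane) ∈ ψ.target := by
      have h1 := ψ.map_source (h p hp).1
      rw [(h p hp).2, hp0] at h1
      convert h1 using 1
      exact plane_ext (by simp) (by simp)
    have hψd : HasFDerivAt ψ.symm (fderiv ℝ ψ.symm 0) 0 :=
      ((hψ.contDiffAt (ψ.open_target.mem_nhds hψ0)).differentiableAt (by simp)).hasFDerivAt
    have hc := HasFDerivAt.comp_hasDerivAt_of_eq (0 : ℝ) hψd hsq
      (plane_ext (by simp) (by simp))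
    rw [map_zero] at hc
    refine hc.congr_of_eventuallyEq ?_
    have hct : ContinuousAt (fun t : ℝ => t • v) 0 := hline.continuousAt
    have : ∀ᶠ t : ℝ in 𝓝 0, t • v ∈ φ.target :=
      hct.eventually (by simpa using φ.open_target.mem_nhds h0t)
    filter_upwards [this] with t ht
    obtain ⟨h1, h2⟩ := h _ (φ.map_target ht)
    rw [φ.right_inv ht] at h2
    rw [← ψ.left_inv h1, h2]
    simp
  rw [hasDerivAt_euclidean_iff] at hf
  have hf' : ∀ y, f y 0 = η y 0 ∧ f y 1 = η y 1 := fun y => by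
    rw [← hlift]; exact ⟨rfl, rfl⟩
  have hD0 : D v 0 = 0 := by
    have h2 : HasDerivAt (fun t : ℝ => η (φ.symm (t • v)) 0) 0 0 := by
      simpa [(hf' _).1] using hf 0
    exact (hDl 0).unique h2
  have hD1 : D v 1 = 0 := by
    have h2 : HasDerivAt (fun t : ℝ => η (φ.symm (t • v)) 1) 0 0 := by
      simpa [(hf' _).2] using hf 1
    exact (hDl 1).unique h2
  exact hinj (by rw [map_zero]; exact space_ext_coord hD0 hD1 hD2)

/-- A fold point has an adapted chart in which the projection has the normal form of a boundary
definite fold point. -/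
lemma IsTwoSheetedLift.exists_isAdaptedChart_of_isFoldPoint {M : Type*} [TopologicalSpace M]
    [ChartedSpace Plane M] {f : M → Plane} {η : M → Space} (H : IsTwoSheetedLift f η)
    [T2Space M] [CompactSpace M] [IsManifold (𝓡 2) ∞ M]
    (hη : Manifold.IsImmersion (𝓡 2) (𝓡 3) ∞ η) {p : M} (hp : IsFoldPoint f p) :
    ∃ Φ, IsAdaptedChart f η p Φ ∧ Φ (η p) = 0 ∧
      ∃ ψ ∈ IsManifold.maximalAtlas (𝓡 2) ∞ Plane, ∀ x ∈ Φ.source, stdProj x ∈ ψ.source ∧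
        ψ (stdProj x) = !₂[Φ x 1, Φ x 2 ^ 2 + Φ x 0] := by
  obtain ⟨φ, hφ, ψ, hψ, hpφ, hp0, h⟩ := hp
  have hψ' := (IsManifold.mem_maximalAtlas_iff_contMDiffOn (I := 𝓡 2) ψ).1 hψ
  rw [contMDiffOn_iff_contDiffOn, contMDiffOn_iff_contDiffOn] at hψ'
  have hηφ := contDiffOn_comp_symm_of_mem_maximalAtlas hη.contMDiff hφ
  have h0t : (0 : Plane) ∈ φ.target := hp0 ▸ φ.map_source hpφ
  let hh : Plane → ℝ := fun y => η (φ.symm y) 2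
  have hhd : ContDiffOn ℝ ∞ hh φ.target := hηφ.coord 2
  obtain ⟨G₀, h0G₀, hG₀s, hG₀, hG₀symm⟩ := exists_openPartialHomeomorph_of_injective_fderiv
    φ.open_target (g := fun y => (!₂[y 0, hh y] : Plane)) (ContDiffOn.vec_two
      (by fun_prop : ContDiff ℝ ∞ fun y : Plane => y 0).contDiffOn hhd) h0t
    (injective_fderiv_height_of_fold_chart H.lift hpφ hp0 hψ'.2 h hηφ
      (by rw [← hp0]; exact injective_fderiv_of_isImmersionAt (hη.isImmersionAt p) hφ hpφ))
  obtain ⟨ε, hε, hbox⟩ := exists_planeBox_subset (G₀.open_source.mem_nhds h0G₀)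
  let G := G₀.restr (planeBox ε)
  have hGs : G.source = planeBox ε := by
    rw [G₀.restr_source' _ (isOpen_planeBox ε)]; exact inter_eq_right.2 hbox
  have hGv : ∀ y ∈ G.source, G y = !₂[y 0, hh y] := fun y _ => hG₀ y
  have hGsymm : ContDiffOn ℝ ∞ G.symm G.target :=
    hG₀symm.mono (by rw [G₀.restr_target]; exact inter_subset_left)
  have hboxt : planeBox ε ⊆ φ.target := hbox.trans hG₀s
  have hhd' : ContDiffOn ℝ ∞ hh G.source := hhd.mono (hGs ▸ hboxt)
  let Φ₀ := foldStraightening ψ G hh hGv hhd'.continuousOn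
  let V : Set M := φ.source ∩ φ ⁻¹' planeBox ε
  have hV : IsOpen V := φ.isOpen_inter_preimage (isOpen_planeBox ε)
  have hK := (H.isCompact_sheetRegion hV.isClosed_compl).isClosed
  -- Two restrictions on the domain: `t < ε²` keeps `±√t` inside the box, and removing the compact
  -- set `sheetRegion f η Vᶜ` discards segments spanned by points outside the fold chart.
  let U : Set Space := (stdProj ⁻¹' ψ.source ∩ (fun x => ψ (stdProj x) 1) ⁻¹' Iio (ε ^ 2)) ∩
    (sheetRegion f η Vᶜ)ᶜ
  have hU : IsOpen U := by
    refine IsOpen.inter (ContinuousOn.isOpen_inter_preimage ?_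
      (ψ.open_source.preimage stdProj_continuous) isOpen_Iio) hK.isOpen_compl
    exact (by fun_prop : Continuous fun x : Plane => x 1).comp_continuousOn
      (ψ.continuousOn.comp stdProj_continuous.continuousOn fun x hx => hx)
  -- the coordinate `w` of a point in the domain
  have hw : ∀ x ∈ Φ₀.source, ∃ w ∈ planeBox ε, w 0 = ψ (stdProj x) 0 ∧ hh w = x 2 ∧
      Φ₀ x = !₂[ψ (stdProj x) 1 - w 1 ^ 2, ψ (stdProj x) 0, w 1] := by
    intro x hx
    have hws : G.symm !₂[ψ (stdProj x) 0, x 2] ∈ G.source := G.map_target hx.2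
    have hGw := G.right_inv hx.2
    rw [hGv _ hws] at hGw
    exact ⟨_, hGs ▸ hws, (plane_vec_inj hGw).1, (plane_vec_inj hGw).2, rfl⟩
  have hinjG : ∀ u ∈ planeBox ε, ∀ w ∈ planeBox ε, u 0 = w 0 → hh u = hh w → u = w := by
    intro u hu w hw h0 h1
    refine G.injOn (hGs ▸ hu) (hGs ▸ hw) ?_
    rw [hGv _ (hGs ▸ hu), hGv _ (hGs ▸ hw), h0, h1]
  have hmemG : ∀ u ∈ planeBox ε, ∀ x, stdProj x ∈ ψ.source → ψ (stdProj x) 0 = u 0 → x 2 = hh u →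
      x ∈ Φ₀.source := by
    intro u hu x hx h0 h2
    refine ⟨hx, ?_⟩
    rw [mem_preimage, h0, h2, ← hGv u (hGs ▸ hu)]
    exact G.map_source (hGs ▸ hu)
  have hsurf : ∀ m ∈ V, η m ∈ Φ₀.source ∧ Φ₀ (η m) = !₂[0, φ m 0, φ m 1] := by
    rintro m ⟨hm, hmb⟩
    obtain ⟨h1, h2⟩ := h m hm
    have hx2 : η m 2 = hh (φ m) := by simp only [hh]; rw [φ.left_inv hm]
    have hs : η m ∈ Φ₀.source :=
      hmemG (φ m) hmb (η m) (by rwa [H.lift]) (by rw [H.lift, h2]; simp) hx2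
    refine ⟨hs, ?_⟩
    obtain ⟨w, hwb, hw0, hw2, hΦw⟩ := hw _ hs
    rw [H.lift, h2] at hΦw hw0
    have hwm : w = φ m := hinjG w hwb _ hmb (by simpa using hw0) (hw2.trans hx2)
    rw [hΦw, hwm]
    exact space_ext_coord (by simp) (by simp) (by simp)
  have hfw : ∀ w ∈ planeBox ε, ∀ x, stdProj x ∈ ψ.source → ψ (stdProj x) 0 = w 0 →
      ψ (stdProj x) 1 = w 1 ^ 2 → f (φ.symm w) = stdProj x := by
    intro w hw x hx h0 h1
    obtain ⟨h2, h3⟩ := h _ (φ.map_target (hboxt hw))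
    refine ψ.injOn h2 hx ?_
    rw [h3, φ.right_inv (hboxt hw)]
    exact plane_ext (by simp [h0]) (by simp [h1])
  have hslice : ∀ s ∈ Ioo (-ε) ε, ∀ v ∈ Ioo (-ε) ε, ∀ w ∈ Ioo (-ε) ε,
      (hh !₂[s, w] ∈ uIcc (hh !₂[s, v]) (hh !₂[s, -v]) ↔ w ^ 2 ≤ v ^ 2) := by
    intro s hs v hv w hw
    have hb : ∀ t ∈ Ioo (-ε) ε, (!₂[s, t] : Plane) ∈ planeBox ε := fun t ht => ⟨hs, ht⟩
    refine mem_uIcc_neg_iff_of_injOn (g := fun t => hh !₂[s, t]) ?_ ?_ hv hw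
    · refine hhd.continuousOn.comp (Continuous.continuousOn ?_) fun t ht => hboxt (hb t ht)
      refine (PiLp.continuous_toLp 2 _).comp (continuous_pi fun i => ?_)
      fin_cases i
      · exact continuous_const
      · exact continuous_id
    · intro t ht t' ht' htt'
      exact (plane_vec_inj (hinjG _ (hb t ht) _ (hb t' ht') rfl htt')).2
  have hS : ∀ x ∈ Φ₀.source, x ∈ U → (x ∈ range η ↔ Φ₀ x 0 = 0) := by
    intro x hx hxU
    constructor
    · rintro ⟨m, rfl⟩
      have hm : m ∈ V := by
        by_contra hm
        exact hxU.2 (mem_sheetRegion_of_mem hm)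
      rw [(hsurf m hm).2]
      simp
    · intro h0
      obtain ⟨w, hwb, hw0, hw2, hΦw⟩ := hw _ hx
      rw [hΦw] at h0
      have h1 : ψ (stdProj x) 1 = w 1 ^ 2 := by simpa [sub_eq_zero] using h0
      exact ⟨φ.symm w, space_ext (by rw [H.lift, hfw w hwb x hx.1 hw0.symm h1]) hw2⟩
  have hN : ∀ x ∈ Φ₀.source, x ∈ U → (x ∈ sheetRegion f η univ ↔ 0 ≤ Φ₀ x 0) := by
    intro x hx hxU
    obtain ⟨w, hwb, hw0, hw2, hΦw⟩ := hw _ hx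
    have hwe : (!₂[w 0, w 1] : Plane) = w := plane_ext rfl rfl
    constructor
    · intro hxN
      by_cases hxS : x ∈ range η
      · exact ((hS x hx hxU).1 hxS).ge
      obtain ⟨m, -, n, -, hms, hns, hfm, hfn, h1, h2⟩ := H.exists_lt_lt_of_mem_sheetRegion hxN hxS
      -- If one end lies in the fold chart, its reflection lies in the same fibre and must be the
      -- other end; monotonicity on the slice then gives `w² ≤ t`.
      have key : ∀ m n, m ∈ V → IsSheetPoint f m → f m = stdProj x → f n = stdProj x → m ≠ n →
          x 2 ∈ uIcc (η m 2) (η n 2) → 0 ≤ Φ₀ x 0 := by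
        rintro m n ⟨hm, hmb⟩ hms hfm hfn hne hmem
        have hm1 : φ m 1 ≠ 0 := fun h1 => not_isSheetPoint_of_fold_chart h hm h1 hms
        have hflip := flipSnd_mem_planeBox hmb
        have hne' : φ.symm (flipSnd (φ m)) ≠ m := by
          intro heq
          apply flipSnd_ne hm1
          rw [← φ.right_inv (hboxt hflip), heq]
        have hfflip : f (φ.symm (flipSnd (φ m))) = f m := by
          rw [apply_symm_flipSnd h (φ.map_source hm) (hboxt hflip), φ.left_inv hm]
        have hn : n = φ.symm (flipSnd (φ m)) := by
          rcases H.card m n _ (hfm.trans hfn.symm) hfflip.symm with h | h | h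
          · exact absurd h hne
          · exact absurd h.symm hne'
          · exact h
        have hs := (h m hm).2
        rw [hfm] at hs
        have hs0 : ψ (stdProj x) 0 = φ m 0 := by rw [hs]; simp
        have hs1 : ψ (stdProj x) 1 = φ m 1 ^ 2 := by rw [hs]; simp
        have e1 : η m 2 = hh !₂[φ m 0, φ m 1] := by
          simp only [hh]
          rw [show (!₂[φ m 0, φ m 1] : Plane) = φ m from plane_ext rfl rfl, φ.left_inv hm]
        have e2 : η n 2 = hh !₂[φ m 0, -φ m 1] := by rw [hn]; rfl
        have e3 : x 2 = hh !₂[φ m 0, w 1] := by rw [← hs0, ← hw0, hwe, hw2]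
        rw [e1, e2, e3, hslice _ hmb.1 _ hmb.2 _ hwb.2] at hmem
        rw [hΦw]
        simp
        linarith
      have hmn : m ≠ n := by rintro rfl; linarith
      by_cases hmV : m ∈ V
      · exact key m n hmV hms hfm hfn hmn (mem_uIcc.2 (Or.inl ⟨h1.le, h2.le⟩))
      by_cases hnV : n ∈ V
      · exact key n m hnV hns hfn hfm hmn.symm (mem_uIcc.2 (Or.inr ⟨h1.le, h2.le⟩))
      · exact absurd (H.mem_sheetRegion_of_le hmV hnV hms hfm hfn
          (mem_uIcc.2 (Or.inl ⟨h1.le, h2.le⟩))) hxU.2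
    · intro h0
      rcases h0.eq_or_lt with h0 | h0
      · obtain ⟨m, rfl⟩ := (hS x hx hxU).2 h0.symm
        exact mem_sheetRegion_of_mem (mem_univ m)
      rw [hΦw] at h0
      have ht : w 1 ^ 2 < ψ (stdProj x) 1 := by simpa using h0
      have htpos : 0 < ψ (stdProj x) 1 := (sq_nonneg _).trans_lt ht
      have htε : ψ (stdProj x) 1 < ε ^ 2 := hxU.1.2
      -- Conversely the segment containing `x` is spanned by the points `(s, ±√t)` of the fold
      -- chart, over the projection of `x`.
      set v := Real.sqrt (ψ (stdProj x) 1) with hv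
      have hvsq : v ^ 2 = ψ (stdProj x) 1 := Real.sq_sqrt htpos.le
      have hvpos : 0 < v := Real.sqrt_pos.2 htpos
      have hvε : v < ε := (Real.sqrt_lt' hε).2 htε
      have hvI : v ∈ Ioo (-ε) ε := ⟨by linarith, hvε⟩
      have hvI' : -v ∈ Ioo (-ε) ε := ⟨by linarith, by linarith⟩
      have hb1 : (!₂[w 0, v] : Plane) ∈ planeBox ε := ⟨hwb.1, hvI⟩
      have hb2 : (!₂[w 0, -v] : Plane) ∈ planeBox ε := ⟨hwb.1, hvI'⟩
      -- Off the fold line `f` is locally injective, which no fold point allows.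
      have hsheet : IsSheetPoint f (φ.symm !₂[w 0, v]) := by
        by_contra hns
        obtain ⟨W, hW, hinj⟩ := exists_injOn_of_fold_chart h (φ.map_target (hboxt hb1))
          (by rw [φ.right_inv (hboxt hb1)]; simpa using hvpos.ne')
        obtain ⟨b, hb, c, hc, hbc, hfbc⟩ := (H.fold _ hns).exists_pair hW
        exact hbc (hinj hb hc hfbc)
      refine H.mem_sheetRegion_of_le (mem_univ _) (mem_univ (φ.symm !₂[w 0, -v])) hsheet
        (hfw _ hb1 x hx.1 (by simp [hw0]) (by simp [hvsq]))
        (hfw _ hb2 x hx.1 (by simp [hw0]) (by simp [hvsq])) ?_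
      have := (hslice (w 0) hwb.1 v hvI (w 1) hwb.2).2 (by rw [hvsq]; exact ht.le)
      rwa [hwe, hw2] at this
  have hpV : p ∈ V := ⟨hpφ, by
    rw [mem_preimage, hp0]; exact ⟨⟨by simpa, by simpa⟩, by simpa, by simpa⟩⟩
  have hpU : η p ∈ U := by
    have h1 := h p hpφ
    refine ⟨⟨?_, ?_⟩, ?_⟩
    · rw [mem_preimage, H.lift]; exact h1.1
    · rw [mem_preimage, H.lift, h1.2, hp0]
      simpa using pow_pos hε 2
    -- A segment through `η p` either has `p` as an end or is degenerate and equal to `η p`; both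
    -- contradict `p ∈ V`.
    · rintro ⟨m, hm, n, hn, ⟨hfmn, -⟩, hseg⟩
      have hseg' := (H.mem_segment_iff hfmn).1 hseg
      rw [H.lift] at hseg'
      rcases H.card p m n hseg'.1 (hseg'.1.trans hfmn) with rfl | rfl | rfl
      · exact hm hpV
      · exact hn hpV
      · have h2 := hseg'.2
        rw [uIcc_self] at h2
        have hpm : p = m := H.eq_of_height_eq hseg'.1 h2
        exact hm (hpm ▸ hpV)
  have hsrc : (Φ₀.restr U).source = Φ₀.source ∩ U := Φ₀.restr_source' U hU
  refine ⟨Φ₀.restr U, ⟨IsBoundaryChart.restr hU (contDiffOn_foldStraightening hψ'.1 hGsymm)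
    (contDiffOn_foldStraightening_symm hψ'.2 hhd') hN hS, ?_, ?_⟩, ?_, ψ, hψ, ?_⟩
  · rw [hsrc]
    exact ⟨(hsurf p hpV).1, hpU⟩
  · have hV' : IsOpen (V ∩ η ⁻¹' U) := hV.inter (hU.preimage H.continuous_lift)
    refine ⟨φ.restr (V ∩ η ⁻¹' U), restr_mem_maximalAtlas _ hφ hV', ?_, ?_⟩
    · rw [φ.restr_source' _ hV']
      exact ⟨hpφ, hpV, hpU⟩
    · intro m hm
      rw [φ.restr_source' _ hV'] at hm
      rw [hsrc]
      exact ⟨⟨(hsurf m hm.2.1).1, hm.2.2⟩, (hsurf m hm.2.1).2⟩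
  · refine (hsurf p hpV).2.trans ?_
    rw [hp0]
    exact space_ext_coord (by simp) (by simp) (by simp)
  · intro x hx
    rw [hsrc] at hx
    refine ⟨hx.1.1, ?_⟩
    obtain ⟨w, -, -, -, hΦw⟩ := hw _ hx.1
    change _ = (!₂[Φ₀ x 1, Φ₀ x 2 ^ 2 + Φ₀ x 0] : Plane)
    rw [hΦw]
    exact plane_ext (by simp) (by simp)

end FoldModel

/-! ### Assembly of the extension -/

section Extension

variable {M : Type*} [TopologicalSpace M] [ChartedSpace Plane M] {f : M → Plane} {η : M → Space}

lemma IsEmbeddingLift.isTwoSheetedLift [IsManifold (𝓡 2) ∞ M] (hη : IsEmbeddingLift f η)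
    (hf : IsFoldMap f)
    (hcard : ∀ r : Plane, (f ⁻¹' {r}).encard ≤ 2) : IsTwoSheetedLift f η where
  continuous_map := hf.smooth.continuous
  continuous_lift := hη.embedding.isEmbedding.continuous
  injective_lift := hη.embedding.isEmbedding.injective
  lift := hη.lift
  fold p hp := hf.fold p fun hs => hp (isSheetPoint_of_surjective_mfderiv hf.smooth hs)
  card a b c hab hac := by
    by_contra! hcon
    obtain ⟨h1, h2, h3⟩ := hcon
    have hsub : ({a, b, c} : Set M) ⊆ f ⁻¹' {f a} := by
      rintro x (rfl | rfl | rfl)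
      · rfl
      · exact hab.symm
      · exact hac.symm
    have h3' : ({a, b, c} : Set M).encard = 3 := Set.encard_eq_three.2 ⟨a, b, c, h1, h2, h3, rfl⟩
    have := (encard_le_encard hsub).trans (hcard _)
    rw [h3'] at this
    exact absurd this (by decide)

lemma surjective_mfderiv_stdProj (x : Space) :
    Function.Surjective (mfderiv (𝓡 3) (𝓡 2) stdProj x) := by
  intro w
  let L : Space →L[ℝ] Plane := LinearMap.toContinuousLinearMap
    { toFun := stdProj
      map_add' := fun _ _ => plane_ext rfl rfl
      map_smul' := fun _ _ => plane_ext rfl rfl }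
  have hL : mfderiv (𝓡 3) (𝓡 2) stdProj x = L := by
    rw [mfderiv_eq_fderiv]
    exact L.fderiv
  refine ⟨atHeight w 0, ?_⟩
  rw [hL]
  exact stdProj_atHeight w 0

/-- The linear identification of `ℝ² × ℝ` with `ℝ³` putting the last factor first. -/
noncomputable def planeProdEquiv : (Plane × ℝ) ≃L[ℝ] Space :=
  LinearEquiv.toContinuousLinearEquiv
    { toFun := fun y => !₂[y.2, y.1 0, y.1 1]
      invFun := fun x => (tailProj x, x 0)
      map_add' := fun _ _ => space_ext_coord rfl rfl rfl
      map_smul' := fun _ _ => space_ext_coord rfl rfl rfl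
      left_inv := fun _ => Prod.ext (plane_ext rfl rfl) rfl
      right_inv := fun _ => space_ext_coord rfl rfl rfl }

/-- In the chart of `M` supplied by the adapted chart, `i` is `y ↦ (0, y 0, y 1)`, the inclusion of
the boundary plane. -/
lemma isImmersionAt_of_isAdaptedChart
    (hN : ∀ x : sheetRegion f η univ, ∃ Φ,
      IsBoundaryChart (sheetRegion f η univ) (range η) Φ ∧ x.1 ∈ Φ.source)
    {p : M} {Φ : OpenPartialHomeomorph Space Space} (h : IsAdaptedChart f η p Φ)
    (i : M → sheetRegion f η univ) (hi : ∀ x, (i x).1 = η x) :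
    letI := regionChartedSpace hN
    Manifold.IsImmersionAtOfComplement ℝ (𝓡 2) (𝓡∂ 3) ∞ i p := by
  let _ := regionChartedSpace hN
  obtain ⟨φ, hφ, hp, hφΦ⟩ := h.exists_chart
  have hs : ∀ q ∈ φ.source, (i q).1 ∈ Φ.source := fun q hq => by rw [hi]; exact (hφΦ q hq).1
  refine Manifold.IsImmersionAtOfComplement.mk_of_charts planeProdEquiv φ
    (regionChart (i p) Φ h.isBoundaryChart) hp (hs p hp) hφ
    (regionChart_mem_maximalAtlas hN _ _) (fun q hq => hs q hq) ?_
  intro y hy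
  rw [OpenPartialHomeomorph.extend_target] at hy
  have hy' : y ∈ φ.target := by simpa using hy.1
  have hq := φ.map_target hy'
  simp only [Function.comp, OpenPartialHomeomorph.extend_coe, OpenPartialHomeomorph.extend_coe_symm,
    modelWithCornersSelf_coe_symm, id, modelWithCornersEuclideanHalfSpace_toFun]
  rw [regionChart_val _ _ (hs _ hq), hi, (hφΦ _ hq).2, φ.right_inv hy']
  rfl

end Extension

/-- For every embedding lift `η` of `f`, the region `N` bounded by `η(M)` is a smooth `3`-manifold
with boundary, smoothly embedded in `ℝ³`, and the restriction to `N` of the standard projection is a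
boundary special generic map which extends `f` through `η : M → N`. -/
theorem proposition3p4 {M : Type*} [TopologicalSpace M] [T2Space M] [CompactSpace M]
    [ConnectedSpace M] [ChartedSpace Plane M] [IsManifold (𝓡 2) ∞ M]
    (horient : IsOrientableSurface M)
    (f : M → Plane) (hf : IsFoldMap f)
    (η : M → Space) (hη : IsEmbeddingLift f η)
    (hcard : ∀ r : Plane, (f ⁻¹' {r}).encard ≤ 2) :
    ∃ (_ : ChartedSpace (EuclideanHalfSpace 3) (boundedRegion (Set.range η)))
      (_ : IsManifold (𝓡∂ 3) ∞ (boundedRegion (Set.range η))),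
      Manifold.IsSmoothEmbedding (𝓡∂ 3) (𝓡 3) ∞
        (Subtype.val : boundedRegion (Set.range η) → Space) ∧
      IsBoundarySpecialGeneric
        (fun y : boundedRegion (Set.range η) => stdProj y.1) ∧
      ∃ i : M → boundedRegion (Set.range η), (∀ x, (i x).1 = η x) ∧
        IsExtensionThrough f (fun y : boundedRegion (Set.range η) => stdProj y.1) i := by
  have H := hη.isTwoSheetedLift hf hcard
  rw [H.boundedRegion_eq]
  have himm := hη.embedding.isImmersion
  have hadapted : ∀ p, ∃ Φ, IsAdaptedChart f η p Φ := by
    intro p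
    by_cases hp : IsSheetPoint f p
    · exact H.exists_isAdaptedChart_of_isSheetPoint hη.embedding.contMDiff hp
    · exact (H.exists_isAdaptedChart_of_isFoldPoint himm (H.fold p hp)).imp fun Φ h => h.1
  have hN : ∀ x : sheetRegion f η univ, ∃ Φ,
      IsBoundaryChart (sheetRegion f η univ) (range η) Φ ∧ x.1 ∈ Φ.source := by
    rintro ⟨x, hx⟩
    by_cases hxS : x ∈ range η
    · obtain ⟨p, rfl⟩ := hxS
      obtain ⟨Φ, h⟩ := hadapted p
      exact ⟨Φ, h.isBoundaryChart, h.mem_source⟩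
    · exact H.exists_isBoundaryChart_of_notMem_range hx hxS
  let _ := regionChartedSpace hN
  have hman := isManifold_region hN
  have hval := isSmoothEmbedding_region_val hN
  let i : M → sheetRegion f η univ := fun x => ⟨η x, mem_sheetRegion_of_mem (mem_univ x)⟩
  have hi : ∀ x, (i x).1 = η x := fun x => rfl
  have hiemb : Manifold.IsSmoothEmbedding (𝓡 2) (𝓡∂ 3) ∞ i := by
    refine ⟨Manifold.IsImmersionOfComplement.isImmersion (F := ℝ) fun p => ?_, ?_⟩
    · obtain ⟨Φ, h⟩ := hadapted p
      exact isImmersionAt_of_isAdaptedChart hN h i hi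
    · exact hη.embedding.isEmbedding.codRestrict _ fun x => mem_sheetRegion_of_mem (mem_univ x)
  have hF : ContMDiff (𝓡∂ 3) (𝓡 2) ∞ (fun y : sheetRegion f η univ => stdProj y.1) :=
    contDiff_stdProj.contMDiff.comp hval.contMDiff
  refine ⟨inferInstance, hman, hval, ⟨?_, ?_, ?_, hF, ?_, ?_⟩, i, hi, hiemb, ?_, H.lift⟩
  · exact isCompact_iff_compactSpace.1 (H.isCompact_sheetRegion isClosed_univ)
  · exact isConnected_iff_connectedSpace.1 H.isConnected_sheetRegion
  · obtain ⟨p⟩ := (inferInstance : Nonempty M)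
    exact ⟨i p, (mem_region_boundary_iff hN _).2 ⟨p, rfl⟩⟩
  · intro x
    have hcomp : mfderiv (𝓡∂ 3) (𝓡 2) (fun y : sheetRegion f η univ => stdProj y.1) x =
        (mfderiv (𝓡 3) (𝓡 2) stdProj x.1).comp
          (mfderiv (𝓡∂ 3) (𝓡 3) (Subtype.val : sheetRegion f η univ → Space) x) :=
      mfderiv_comp x (contDiff_stdProj.contMDiff.mdifferentiableAt (by simp))
        (hval.contMDiff.mdifferentiableAt (by simp))
    rw [hcomp]
    exact (surjective_mfderiv_stdProj x.1).comp (surjective_mfderiv_region_val hN x)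
  · rintro x ⟨hx, hsing⟩
    obtain ⟨p, hpx⟩ := (mem_region_boundary_iff hN x).1 hx
    obtain rfl : i p = x := Subtype.ext hpx
    -- If the differential of `f` at `p` were onto, the image of the differential of `i` would
    -- consist of vectors tangent to the boundary which already map onto the plane.
    have hp : ¬ Function.Surjective (mfderiv (𝓡 2) (𝓡 2) f p) := by
      intro hsurj
      refine hsing fun w => ?_
      obtain ⟨v, hv⟩ := hsurj w
      have hidiff : MDifferentiableAt (𝓡 2) (𝓡∂ 3) i p :=
        hiemb.contMDiff.mdifferentiableAt (by simp)
      refine ⟨mfderiv (𝓡 2) (𝓡∂ 3) i p v, ?_, ?_⟩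
      · obtain ⟨Φ, h, hxΦ, hc⟩ := region_chartAt hN (i p)
        have hext : MDifferentiableAt (𝓡∂ 3) (𝓡 3) (extChartAt (𝓡∂ 3) (i p)) (i p) :=
          mdifferentiableAt_extChartAt (mem_chart_source _ (i p))
        have hcomp := mfderiv_comp p hext hidiff
        -- The normal coordinate of `i` vanishes identically near `p`, so the normal component of
        -- every vector in the image of its differential is zero.
        have hzero : ∀ᶠ q in 𝓝 p, (extChartAt (𝓡∂ 3) (i p) (i q)) 0 = 0 := by
          have hsrc : ∀ᶠ q in 𝓝 p, η q ∈ Φ.source :=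
            H.continuous_lift.continuousAt.eventually (Φ.open_source.mem_nhds hxΦ)
          filter_upwards [hsrc] with q hq
          simp only [extChartAt, hc, OpenPartialHomeomorph.extend_coe, Function.comp,
            modelWithCornersEuclideanHalfSpace_toFun]
          rw [regionChart_val (i p) h hq]
          exact (h.mem_boundary_iff _ hq).1 ⟨q, rfl⟩
        let P : Space →L[ℝ] ℝ := EuclideanSpace.proj 0
        have hPc : mfderiv (𝓡 2) 𝓘(ℝ, ℝ) (P ∘ (extChartAt (𝓡∂ 3) (i p) ∘ i)) p = 0 := by
          have : P ∘ (extChartAt (𝓡∂ 3) (i p) ∘ i) =ᶠ[𝓝 p] fun _ => (0 : ℝ) := by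
            filter_upwards [hzero] with q hq
            exact hq
          rw [this.mfderiv_eq, mfderiv_const]
          rfl
        rw [mfderiv_comp p (P.contDiff.contMDiff.mdifferentiableAt (n := 1) (by simp))
          (hext.comp p hidiff), hcomp] at hPc
        have := DFunLike.congr_fun hPc v
        rw [mfderiv_eq_fderiv, P.fderiv] at this
        exact this
      · have hcomp := mfderiv_comp p (hF.mdifferentiableAt (by simp)) hidiff
        rw [← hv]
        have hfi : (fun y : sheetRegion f η univ => stdProj y.1) ∘ i = f := funext H.lift
        rw [hfi] at hcomp
        exact (DFunLike.congr_fun hcomp v).symm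
    obtain ⟨Φ, h, h0, ψ, hψ, hform⟩ := H.exists_isAdaptedChart_of_isFoldPoint himm (hf.fold p hp)
    refine ⟨hx, regionChart (i p) Φ h.isBoundaryChart, regionChart_mem_maximalAtlas hN _ _, ψ, hψ,
      h.mem_source, ?_, ?_⟩
    · rw [regionChart_val _ _ h.mem_source]
      exact h0
    · intro q hq
      rw [regionChart_val _ _ hq]
      exact hform _ hq
  · ext x
    rw [mem_region_boundary_iff hN]
    constructor
    · rintro ⟨p, rfl⟩
      exact ⟨p, rfl⟩
    · rintro ⟨p, hp⟩
      exact ⟨p, Subtype.ext hp⟩
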